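/- Let $n\in\mathbb N_0$. Let $A_a,B_a$ ($a=1,\dots,n$) be $2n$ decoupled harmonic oscillators, $[A_a,A_b^\dagger]=[B_a,B_b^\dagger]=\delta_{ab}$, acting in the standard way on the Fock space $\mathcal F_n$, i.e. the complex inner product space with orthonormal basis the occupation-number vectors $|\mu,\nu\rangle$, $\mu,\nu\in\mathbb N_0^n$ (finite linear combinations), and let $|0\rangle$ be the vacuum. Let $$J_z=\tfrac12\sum_a(A_a^\dagger A_a-B_a^\dagger B_a),\qquad J_+=\sum_aA_a^\dagger B_a,\qquad J_-=\sum_aB_a^\dagger A_a$$ be the total angular momentum operators. For $j_1,\dots,j_n\in\frac12\mathbb N_0$ identify the tensor product $F_{j_1}\otimes\dots\otimes F_{j_n}$ of irreducible $\mathrm{SU}(2)$ representations with the span of the $|\mu,\nu\rangle$ such that $\mu_a+\nu_a=2j_a$ for all $a$, let $\mathrm{Inv}_{\mathrm{SU}(2)}(F_{j_1}\otimes\dots\otimes F_{j_n})$ be its subspace of vectors annihilated by $J_z,J_\pm$, and for $J\in\mathbb N_0$ let $$\mathcal H_n^J=\bigoplus_{\sum_aj_a=J}\mathrm{Inv}_{\mathrm{SU}(2)}(F_{j_1}\otimes\dots\otimes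 F_{j_n}),\qquad \mathcal H_n=\bigoplus_{J\ge0}\mathcal H_n^J$$ (algebraic direct sums): the intertwiners of total area $J$, and all intertwiners. Let $$E_{ab}=A_a^\dagger A_b+B_a^\dagger B_b+\delta_{ab},\qquad F_{ab}=B_aA_b-A_aB_b,\qquad \widetilde F_{ab}=B_a^\dagger A_b^\dagger-A_a^\dagger B_b^\dagger .$$ Let $\mathrm{SO}^*(2n)$ be the group of all $g\in\mathrm{SU}(n,n)$ with $g^{T}\begin{pmatrix}0&1\\1&0\end{pmatrix}g=\begin{pmatrix}0&1\\1&0\end{pmatrix}$, let $\mathfrak g=\mathfrak{so}^*(2n)=\left\{\begin{pmatrix}X&Y\\-\overline Y&\overline X\end{pmatrix}: X^*=-X,\ Y^T=-Y\right\}$ be its Lie algebra and $K=\{\mathrm{diag}(U,\overline U):U\in\mathrm U(n)\}$ its maximal compact subgroup. A $(\mathfrak g,K)$-module is a complex vector space with actions of $\mathfrak g$ and $K$ such that $kXv=(\mathrm{Ad}(k)X)kv$, each $Kv$ spans a finite-dimensional space on which $K$ acts continuously, and $\frac{d}{dt}\big|_{t=0}e^{tY}v=Yv$ for $Y$ in the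 Lie algebra of $K$. It is unitary for a given inner product if $\mathfrak g$ acts by skew-adjoint and $K$ by unitary operators. Then the following hold. 1. Each $E_{ab},F_{ab},\widetilde F_{ab}$ commutes with $J_z,J_+,J_-$, and these operators satisfy the relations of $\mathfrak{so}^*(2n)_{\mathbb C}$: $F_{ba}=-F_{ab}$, $\widetilde F_{ba}=-\widetilde F_{ab}$ and $$\begin{aligned} [E_{ab},E_{cd}]&=\delta_{cb}E_{ad}-\delta_{ad}E_{cb},\\ [E_{ab},\widetilde F_{cd}]&=\delta_{bc}\widetilde F_{ad}-\delta_{bd}\widetilde F_{ac},\\ [E_{ab},F_{cd}]&=\delta_{ad}F_{bc}-\delta_{ac}F_{bd},\\ [F_{ab},\widetilde F_{cd}]&=\delta_{db}E_{ca}+\delta_{ca}E_{db}-\delta_{cb}E_{da}-\delta_{da}E_{cb},\\ [F_{ab},F_{cd}]&=[\widetilde F_{ab},\widetilde F_{cd}]=0 . \end{aligned}$$ Moreover $\langle E_{ab}v,w\rangle=\langle v,E_{ba}w\rangle$ and $\langle F_{ab}v,w\rangle=\langle v,\widetilde F_{ab}w\rangle$ for all $v,w\in\mathcal F_n$. 2.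 $\mathcal H_n$ is the space of all vectors of $\mathcal F_n$ annihilated by $J_z,J_\pm$. It is stable under all $E_{ab},F_{ab},\widetilde F_{ab}$, and its only subspaces stable under all of them are $0$ and $\mathcal H_n$. There is an irreducible $(\mathfrak g,K)$-module structure on $\mathcal H_n$, unitary for the Fock inner product, in which $\begin{pmatrix}X&Y\\-\overline Y&\overline X\end{pmatrix}\in\mathfrak g$ acts as $\sum_{a,b}\left(X_{ab}E_{ab}+\tfrac12Y_{ab}\widetilde F_{ab}-\tfrac12\overline{Y_{ab}}F_{ab}\right)$, and in which $K\cong\mathrm U(n)$ preserves each $\mathcal H_n^J$. 3. Let $n\ge2$ and $J\in\mathbb N_0$. Then $\mathcal H_n^J$ is stable under all $E_{ab}$, its only subspaces stable under all $E_{ab}$ are $0$ and $\mathcal H_n^J$, and $$|\psi_J\rangle=\frac1{\sqrt{J!\,(J+1)!}}\,(\widetilde F_{12})^J|0\rangle$$ is a unit vector of $\mathcal H_n^J$ which is a highest weight vector of weight $[J+1,J+1,1,\dots,1]$: $E_{aa}\psi_J=(J+1)\psi_J$ for $a\le2$, $E_{aa}\psi_J=\psi_J$ for $a>2$, and $E_{ab}\psi_J=0$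 for $a<b$. Up to a phase it is the only highest weight vector of norm $1$ in $\mathcal H_n^J$: if $w\in\mathcal H_n^J$ has norm $1$, is an eigenvector of every $E_{aa}$ and satisfies $E_{ab}w=0$ for all $a<b$, then $w=e^{i\theta}\psi_J$ for some $\theta\in\mathbb R$. -/

import Mathlib

open Matrix
open scoped ComplexConjugate

attribute [local instance] LieRing.ofAssociativeRing

noncomputable section

namespace SOStar

/-! ### The Fock space of `2n` harmonic oscillators -/

/-- Occupation numbers of the `2n` oscillators: `μ (Sum.inl a)` is the number of quanta of the
oscillator `A_a`, and `μ (Sum.inr a)` is that of `B_a`. -/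
abbrev Occ (n : ℕ) : Type := (Fin n ⊕ Fin n) →₀ ℕ

/-- The (algebraic) Fock space: the complex vector space spanned by the occupation number
vectors `|μ⟩`. -/
abbrev Fock (n : ℕ) : Type := Occ n →₀ ℂ

/-- The basis vector `|μ⟩`. -/
def ket {n : ℕ} (μ : Occ n) : Fock n := Finsupp.single μ 1

/-- The vacuum `|0⟩`. -/
def vacuum (n : ℕ) : Fock n := ket 0

/-- The inner product `⟨v|w⟩ = ∑_μ conj (v_μ) w_μ`, for which the vectors `|μ⟩` are
orthonormal. It is conjugate linear in the first argument. -/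
def fockInner (n : ℕ) : Fock n →ₗ⋆[ℂ] Fock n →ₗ[ℂ] ℂ :=
  LinearMap.mk₂'ₛₗ (starRingEnd ℂ) (RingHom.id ℂ)
    (fun v w => v.sum fun μ c => conj c * w μ)
    (fun v₁ v₂ w => by
      classical
      exact Finsupp.sum_add_index' (by simp) (by intros; simp [add_mul]))
    (fun c v w => by
      rw [Finsupp.sum_smul_index (by simp), Finsupp.smul_sum]
      exact Finsupp.sum_congr (by intros; simp [mul_assoc]))
    (fun v w₁ w₂ => by simp [mul_add, Finsupp.sum_add])
    (fun c v w => by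
      simp only [RingHom.id_apply, Finsupp.smul_sum]
      exact Finsupp.sum_congr (by intros; simp [mul_left_comm]))

/-- Annihilation operator of the oscillator `i`: `|μ⟩ ↦ √μ_i |μ - e_i⟩` (zero if `μ_i = 0`). -/
def lower {n : ℕ} (i : Fin n ⊕ Fin n) : Module.End ℂ (Fock n) :=
  Finsupp.linearCombination ℂ fun μ : Occ n =>
    (Real.sqrt (μ i) : ℂ) • ket (μ - Finsupp.single i 1)

/-- Creation operator of the oscillator `i`: `|μ⟩ ↦ √(μ_i + 1) |μ + e_i⟩`. -/
def raise {n : ℕ} (i : Fin n ⊕ Fin n) : Module.End ℂ (Fock n) :=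
  Finsupp.linearCombination ℂ fun μ : Occ n =>
    (Real.sqrt (μ i + 1) : ℂ) • ket (μ + Finsupp.single i 1)

section Operators

variable {n : ℕ}

/-- `A_a` -/
def opA (a : Fin n) : Module.End ℂ (Fock n) := lower (Sum.inl a)
/-- `B_a` -/
def opB (a : Fin n) : Module.End ℂ (Fock n) := lower (Sum.inr a)
/-- `A†_a` -/
def opAd (a : Fin n) : Module.End ℂ (Fock n) := raise (Sum.inl a)
/-- `B†_a` -/
def opBd (a : Fin n) : Module.End ℂ (Fock n) := raise (Sum.inr a)

/-- `E_ab = A†_a A_b + B†_a B_b + δ_ab` -/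
def opE (a b : Fin n) : Module.End ℂ (Fock n) :=
  opAd a * opA b + opBd a * opB b + if a = b then 1 else 0

/-- `F_ab = B_a A_b - A_a B_b` -/
def opF (a b : Fin n) : Module.End ℂ (Fock n) := opB a * opA b - opA a * opB b

/-- `F̃_ab = B†_a A†_b - A†_a B†_b` -/
def opFt (a b : Fin n) : Module.End ℂ (Fock n) := opBd a * opAd b - opAd a * opBd b

end Operators

/-! ### `SU(2)` and intertwiners -/

/-- `J_z = ∑_a (A†_a A_a - B†_a B_a) / 2` -/
def opJz (n : ℕ) : Module.End ℂ (Fock n) :=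
  ∑ a : Fin n, (1 / 2 : ℂ) • (opAd a * opA a - opBd a * opB a)

/-- `J_+ = ∑_a A†_a B_a` -/
def opJp (n : ℕ) : Module.End ℂ (Fock n) := ∑ a : Fin n, opAd a * opB a

/-- `J_- = ∑_a B†_a A_a` -/
def opJm (n : ℕ) : Module.End ℂ (Fock n) := ∑ a : Fin n, opBd a * opA a

/-- A scalar operator for `SU(2)`: it commutes with the total angular momentum. -/
def IsScalarOp {n : ℕ} (T : Module.End ℂ (Fock n)) : Prop :=
  Commute (opJz n) T ∧ Commute (opJp n) T ∧ Commute (opJm n) T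

/-- The vectors annihilated by the total angular momentum. -/
def invariants (n : ℕ) : Submodule ℂ (Fock n) :=
  LinearMap.ker (opJz n) ⊓ LinearMap.ker (opJp n) ⊓ LinearMap.ker (opJm n)

/-- The space `F_{j_1} ⊗ ⋯ ⊗ F_{j_n}` with `k a = 2 j_a`, in the oscillator realisation: it is
spanned by the vectors `|j_1,m_1⟩ ⊗ ⋯ ⊗ |j_n,m_n⟩`, where `|j,m⟩` has `j + m` quanta of the
oscillator `A` and `j - m` quanta of the oscillator `B`. -/
def legSpace {n : ℕ} (k : Fin n → ℕ) : Submodule ℂ (Fock n) :=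
  Submodule.span ℂ {v | ∃ μ : Occ n, (∀ a, μ (Sum.inl a) + μ (Sum.inr a) = k a) ∧ v = ket μ}

/-- `Inv_{SU(2)} (F_{j_1} ⊗ ⋯ ⊗ F_{j_n})` with `k a = 2 j_a`. -/
def invLeg {n : ℕ} (k : Fin n → ℕ) : Submodule ℂ (Fock n) := legSpace k ⊓ invariants n

/-- The space `H_n^J` of `n`-valent intertwiners with total area `∑_a j_a = J`. -/
def areaSpace (n J : ℕ) : Submodule ℂ (Fock n) :=
  ⨆ k : {k : Fin n → ℕ // ∑ a, k a = 2 * J}, invLeg k.1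

/-- The space `H_n = ⨁_J H_n^J` of all `n`-valent intertwiners. -/
def intertwinerSpace (n : ℕ) : Submodule ℂ (Fock n) := ⨆ J : ℕ, areaSpace n J

/-! ### The group `SO*(2n)`, its maximal compact subgroup and its Lie algebra -/

/-- Complex `2n × 2n` matrices. -/
abbrev Mat2 (n : ℕ) : Type := Matrix (Fin n ⊕ Fin n) (Fin n ⊕ Fin n) ℂ

/-- The matrix `diag(1, -1)` of the Hermitian form of signature `(n, n)`. -/
def hermForm (n : ℕ) : Mat2 n := fromBlocks 1 0 0 (-1)

/-- The matrix of the symmetric bilinear form `∑_a (x_a y_{n+a} + y_a x_{n+a})`. -/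
def symmForm (n : ℕ) : Mat2 n := fromBlocks 0 1 1 0

/-- The group `SO*(2n)`: the elements of `SU(n,n)` that preserve the symmetric form. -/
def group (n : ℕ) : Subgroup (Mat2 n)ˣ where
  carrier := {g | (g : Mat2 n).det = 1 ∧
    (g : Mat2 n)ᴴ * hermForm n * (g : Mat2 n) = hermForm n ∧
    (g : Mat2 n)ᵀ * symmForm n * (g : Mat2 n) = symmForm n}
  one_mem' := by simp
  mul_mem' := by
    rintro g h ⟨g1, g2, g3⟩ ⟨h1, h2, h3⟩
    refine ⟨by simp [g1, h1], ?_, ?_⟩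
    · calc _ = (h : Mat2 n)ᴴ * ((g : Mat2 n)ᴴ * hermForm n * (g : Mat2 n)) * (h : Mat2 n) := by
            simp [conjTranspose_mul, Matrix.mul_assoc]
        _ = _ := by rw [g2, h2]
    · calc _ = (h : Mat2 n)ᵀ * ((g : Mat2 n)ᵀ * symmForm n * (g : Mat2 n)) * (h : Mat2 n) := by
            simp [transpose_mul, Matrix.mul_assoc]
        _ = _ := by rw [g3, h3]
  inv_mem' := by
    rintro g ⟨g1, g2, g3⟩
    have e : (g : Mat2 n) * ((g⁻¹ : (Mat2 n)ˣ) : Mat2 n) = 1 := by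
      rw [← Units.val_mul]; simp
    have e1 : ((g⁻¹ : (Mat2 n)ˣ) : Mat2 n)ᴴ * (g : Mat2 n)ᴴ = 1 := by
      rw [← conjTranspose_mul, e]; simp
    have e2 : ((g⁻¹ : (Mat2 n)ˣ) : Mat2 n)ᵀ * (g : Mat2 n)ᵀ = 1 := by
      rw [← transpose_mul, e]; simp
    refine ⟨?_, ?_, ?_⟩
    · have := congrArg Matrix.det e
      rw [det_mul, g1, det_one, one_mul] at this
      exact this
    · calc _ = ((g⁻¹ : (Mat2 n)ˣ) : Mat2 n)ᴴ *
              ((g : Mat2 n)ᴴ * hermForm n * (g : Mat2 n)) * ((g⁻¹ : (Mat2 n)ˣ) : Mat2 n) := by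
            rw [g2]
        _ = (((g⁻¹ : (Mat2 n)ˣ) : Mat2 n)ᴴ * (g : Mat2 n)ᴴ) * hermForm n *
              ((g : Mat2 n) * ((g⁻¹ : (Mat2 n)ˣ) : Mat2 n)) := by
            simp only [Matrix.mul_assoc]
        _ = _ := by rw [e1, e]; simp
    · calc _ = ((g⁻¹ : (Mat2 n)ˣ) : Mat2 n)ᵀ *
              ((g : Mat2 n)ᵀ * symmForm n * (g : Mat2 n)) * ((g⁻¹ : (Mat2 n)ˣ) : Mat2 n) := by
            rw [g3]
        _ = (((g⁻¹ : (Mat2 n)ˣ) : Mat2 n)ᵀ * (g : Mat2 n)ᵀ) * symmForm n *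
              ((g : Mat2 n) * ((g⁻¹ : (Mat2 n)ˣ) : Mat2 n)) := by
            simp only [Matrix.mul_assoc]
        _ = _ := by rw [e2, e]; simp

/-- The maximal compact subgroup `K` of `SO*(2n)`: the elements of the form `diag(U, conj U)`
with `U` in `U(n)`. -/
def maxCompact (n : ℕ) : Subgroup (group n) where
  carrier := {g | ∃ U ∈ Matrix.unitaryGroup (Fin n) ℂ,
    ((g : (Mat2 n)ˣ) : Mat2 n) = fromBlocks U 0 0 (U.map conj)}
  one_mem' := ⟨1, one_mem _, by simp⟩
  mul_mem' := by
    rintro g h ⟨U, hU, gU⟩ ⟨W, hW, hW'⟩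
    refine ⟨U * W, mul_mem hU hW, ?_⟩
    simp [gU, hW', fromBlocks_multiply, Matrix.map_mul]
  inv_mem' := by
    rintro g ⟨U, hU, gU⟩
    refine ⟨star U, Unitary.star_mem hU, ?_⟩
    have h1 : star U * U = 1 := Unitary.star_mul_self_of_mem hU
    have h2 : (star U).map conj * U.map conj = 1 := by
      rw [← Matrix.map_mul, h1]; simp
    have h3 : fromBlocks (star U) 0 0 ((star U).map conj) * ((g : (Mat2 n)ˣ) : Mat2 n) = 1 := by
      rw [gU]; simp [fromBlocks_multiply, h1, h2]
    have h4 : (((g : (Mat2 n)ˣ)⁻¹ : (Mat2 n)ˣ) : Mat2 n)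
        = fromBlocks (star U) 0 0 ((star U).map conj) := by
      rw [← one_mul (((g : (Mat2 n)ˣ)⁻¹ : (Mat2 n)ˣ) : Mat2 n), ← h3, Matrix.mul_assoc,
        ← Units.val_mul]
      simp
    exact h4

/-- The real Lie algebra `so*(2n)`: the elements of `su(n,n)` that are infinitesimal
symmetries of the symmetric form. -/
def lieAlg (n : ℕ) : LieSubalgebra ℝ (Mat2 n) where
  carrier := {V | V.trace = 0 ∧ Vᴴ * hermForm n = -(hermForm n * V) ∧
    Vᵀ * symmForm n = -(symmForm n * V)}
  zero_mem' := by simp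
  add_mem' := by
    rintro V W ⟨v1, v2, v3⟩ ⟨w1, w2, w3⟩
    refine ⟨by simp [v1, w1], ?_, ?_⟩
    · rw [conjTranspose_add, Matrix.add_mul, v2, w2, Matrix.mul_add]; abel
    · rw [transpose_add, Matrix.add_mul, v3, w3, Matrix.mul_add]; abel
  smul_mem' := by
    rintro c V ⟨v1, v2, v3⟩
    refine ⟨by simp [v1], ?_, ?_⟩
    · simp [conjTranspose_smul, v2]
    · simp [transpose_smul, v3]
  lie_mem' := by
    rintro V W ⟨v1, v2, v3⟩ ⟨w1, w2, w3⟩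
    refine ⟨?_, ?_, ?_⟩
    · rw [Ring.lie_def, trace_sub, trace_mul_comm, sub_self]
    · rw [Ring.lie_def, conjTranspose_sub, conjTranspose_mul, conjTranspose_mul, Matrix.sub_mul,
        Matrix.mul_assoc, Matrix.mul_assoc, v2, w2, Matrix.mul_neg, Matrix.mul_neg,
        ← Matrix.mul_assoc, ← Matrix.mul_assoc, v2, w2, Matrix.mul_sub]
      simp only [Matrix.neg_mul, Matrix.mul_assoc, neg_neg]; abel
    · rw [Ring.lie_def, transpose_sub, transpose_mul, transpose_mul, Matrix.sub_mul,
        Matrix.mul_assoc, Matrix.mul_assoc, v3, w3, Matrix.mul_neg, Matrix.mul_neg,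
        ← Matrix.mul_assoc, ← Matrix.mul_assoc, v3, w3, Matrix.mul_sub]
      simp only [Matrix.neg_mul, Matrix.mul_assoc, neg_neg]; abel

/-- The matrix underlying an element of the maximal compact subgroup. -/
def kMat {n : ℕ} (k : maxCompact n) : Mat2 n := (((k : group n) : (Mat2 n)ˣ) : Mat2 n)

/-- `(𝔤, K)`-modules for `G = SO*(2n)`: a `𝔤`-module and `K`-module structure on a complex vector
space such that `k X v = Ad(k)X k v`, every `v` is `K`-finite with `K` acting continuously on the
finite-dimensional span of `K v`, and the derivative of the action of `K` is that of its Lie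
algebra. Since the span of `K v` is finite dimensional, continuity and derivatives can be tested
on linear functionals. -/
structure GKModule (n : ℕ) (M : Type) [AddCommGroup M] [Module ℂ M] where
  /-- the action of `𝔤` -/
  lieAction : lieAlg n →ₗ⁅ℝ⁆ Module.End ℂ M
  /-- the action of `K` -/
  compactAction : maxCompact n →* Module.End ℂ M
  ad_compat : ∀ (k : maxCompact n) (X : lieAlg n), ∃ Y : lieAlg n,
    (Y : Mat2 n) = kMat k * (X : Mat2 n) * kMat k⁻¹ ∧
    compactAction k * lieAction X = lieAction Y * compactAction k
  finite : ∀ v : M,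
    FiniteDimensional ℂ (Submodule.span ℂ (Set.range fun k : maxCompact n => compactAction k v))
  continuous : ∀ (v : M) (f : M →ₗ[ℂ] ℂ), Continuous fun k : maxCompact n => f (compactAction k v)
  deriv : ∀ (Y : lieAlg n) (γ : ℝ → maxCompact n),
    (∀ t : ℝ, kMat (γ t) = NormedSpace.exp (t • (Y : Mat2 n))) →
    ∀ (v : M) (f : M →ₗ[ℂ] ℂ),
      HasDerivAt (fun t : ℝ => f (compactAction (γ t) v)) (f (lieAction Y v)) 0

/-- The `(𝔤, K)`-module is unitary with respect to the given inner product: the latter is a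
positive definite Hermitian form, `𝔤` acts by skew-adjoint operators and `K` by unitary ones. -/
structure GKModule.IsUnitary {n : ℕ} {M : Type} [AddCommGroup M] [Module ℂ M]
    (π : GKModule n M) (form : M →ₗ⋆[ℂ] M →ₗ[ℂ] ℂ) : Prop where
  hermitian : ∀ v w, conj (form v w) = form w v
  pos : ∀ v, v ≠ 0 → 0 < (form v v).re
  skew : ∀ X v w, form (π.lieAction X v) w = -form v (π.lieAction X w)
  unitary : ∀ k v w, form (π.compactAction k v) (π.compactAction k w) = form v w

/-- The `(𝔤, K)`-module is irreducible. -/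
def GKModule.IsIrreducible {n : ℕ} {M : Type} [AddCommGroup M] [Module ℂ M]
    (π : GKModule n M) : Prop :=
  Nontrivial M ∧ ∀ W : Submodule ℂ M,
    (∀ X, ∀ v ∈ W, π.lieAction X v ∈ W) → (∀ k, ∀ v ∈ W, π.compactAction k v ∈ W) →
    W = ⊥ ∨ W = ⊤

/-- The operator by which the matrix `(X Y; Z -Xᵀ)` (with `Y`, `Z` antisymmetric) acts when the
matrices `(Δ_ab 0; 0 -Δ_ba)`, `(0 0; Δ_ab - Δ_ba 0)` and `(0 Δ_ab - Δ_ba; 0 0)`, which span the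
complexification of `so*(2n)`, act as `E_ab`, `F_ab` and `F̃_ab` respectively; the factors `1/2`
are there because the antisymmetric matrices `Δ_ab - Δ_ba` are summed over all `a, b`. -/
def opOf {n : ℕ} (V : Mat2 n) : Module.End ℂ (Fock n) :=
  ∑ a : Fin n, ∑ b : Fin n,
    (V (Sum.inl a) (Sum.inl b) • opE a b
      + ((1 / 2 : ℂ) * V (Sum.inr a) (Sum.inl b)) • opF a b
      + ((1 / 2 : ℂ) * V (Sum.inl a) (Sum.inr b)) • opFt a b)

/-- The commutation relations of `so*(2n)_ℂ` (for elements of an associative ring, with the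
commutator `⁅x, y⁆ = x * y - y * x`). -/
structure Relations {n : ℕ} {L : Type} [Ring L] (E F Ft : Fin n → Fin n → L) : Prop where
  E_E : ∀ a b c d, ⁅E a b, E c d⁆ = (if c = b then E a d else 0) - (if a = d then E c b else 0)
  E_Ft : ∀ a b c d,
    ⁅E a b, Ft c d⁆ = (if b = c then Ft a d else 0) - (if b = d then Ft a c else 0)
  E_F : ∀ a b c d, ⁅E a b, F c d⁆ = (if a = d then F b c else 0) - (if a = c then F b d else 0)
  F_Ft : ∀ a b c d, ⁅F a b, Ft c d⁆ = (if d = b then E c a else 0) + (if c = a then E d b else 0)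
    - (if c = b then E d a else 0) - (if d = a then E c b else 0)
  F_F : ∀ a b c d, ⁅F a b, F c d⁆ = 0
  Ft_Ft : ∀ a b c d, ⁅Ft a b, Ft c d⁆ = 0
  F_antisymm : ∀ a b, F b a = -F a b
  Ft_antisymm : ∀ a b, Ft b a = -Ft a b

/-- `v` is a highest weight vector of weight `[l_1, …, l_n]` for the action of `𝔲(n)_ℂ` by the
operators `E_ab`. -/
def IsHighestWeight {n : ℕ} (l : Fin n → ℂ) (v : Fock n) : Prop :=
  v ≠ 0 ∧ (∀ a, opE a a v = l a • v) ∧ ∀ a b, a < b → opE a b v = 0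

/-- `|ψ_J⟩ = (J! (J+1)!)^{-1/2} (F̃_12)^J |0⟩`. -/
def psi {n : ℕ} (hn : 2 ≤ n) (J : ℕ) : Fock n :=
  ((Real.sqrt ((J.factorial : ℝ) * ((J + 1).factorial : ℝ)))⁻¹ : ℂ) •
    ((opFt (⟨0, by omega⟩ : Fin n) ⟨1, by omega⟩) ^ J) (vacuum n)

end SOStar

end

namespace SOStar

variable {n : ℕ}

/-! ### Oscillators -/

/-! For each leg the pairs $(A_a^\dagger,B_a^\dagger)$ and $(A_a,B_a)$ are SU(2) doublets; $E_{ab}$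
is a pairing of two doublets and $F_{ab},\widetilde F_{ab}$ are $2\times2$ determinants, hence
invariant. The commutation relations follow from the canonical ones by the Leibniz rule.

The engine is a Capelli identity (`CCR.sum_sum_mul`): $\sum_{ab}\widetilde
F_{ab}F_{ab}=2(N_BN_A-J_-J_++N_B)$. On an invariant vector of area $J$ one has $J_+=0$ and
$N_A=N_B=J$, so the sum acts as the scalar $2J(J+1)$. An invariant vector killed by every $F_{ab}$
is therefore a multiple of the vacuum, and every vector of area $J+1$ is a combination of vectors
$\widetilde F_{ab}u$ with $u$ of area $J$. Going down to the vacuum and up again proves that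
$\mathcal H_n$ is irreducible.

At fixed area, let $v$ be killed by $E_{ab}$ for $a<b$. For $b$ beyond the first two legs,
$E_{1b}v=E_{2b}v=0$ is a linear system for $A_bv,B_bv$ with determinant $\widetilde F_{12}$, which
is injective; so only the first two legs are occupied, the Capelli sum reduces to $2\widetilde
F_{12}F_{12}$, and $v$ is a multiple of $\widetilde F_{12}^J|0\rangle$. Every nonzero stable
subspace contains such a $v$; a proper one and its orthogonal complement would share it, which is
absurd (`areaSpace_irreducible`).

For the $(\mathfrak g,K)$-structure, $(A^\dagger,B)$ and $(A,-B^\dagger)$ again satisfy the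
canonical relations, and $V\in\mathfrak g$ acts as $\sum V_{ij}z_i z'_j$ in them, which makes the
bracket relation formal (`quad_commutator`). The group $K$ acts by $\det U$ times the substitution
$U$ on creation operators, built on polynomials through the Bargmann transform; the determinant
integrates the constant $\delta_{ab}$ in $E_{ab}$. -/

lemma lower_apply (i : Fin n ⊕ Fin n) (v : Fock n) (μ : Occ n) :
    lower i v μ = (Real.sqrt (μ i + 1) : ℂ) * v (μ + Finsupp.single i 1) := by
  induction v using Finsupp.induction_linear with
  | zero => simp
  | add v w hv hw => simp [hv, hw, mul_add]
  | single ν c =>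
    classical
    simp only [lower, Finsupp.linearCombination_single, ket, Finsupp.smul_apply, smul_eq_mul,
      Finsupp.single_apply]
    by_cases h : ν = μ + Finsupp.single i 1
    · subst h
      simp [mul_comm]
    · rw [if_neg h]
      -- If `ν i = 0`, truncated subtraction leaves `ν` unchanged, but the factor `√(ν i)` vanishes.
      by_cases h0 : ν i = 0
      · simp [h0]
      · rw [if_neg]
        · simp
        · rintro rfl
          apply h
          ext j
          by_cases hj : j = i
          · subst hj; simp; omega
          · simp [Ne.symm hj]

lemma raise_apply (i : Fin n ⊕ Fin n) (v : Fock n) (μ : Occ n) :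
    raise i v μ = (Real.sqrt (μ i) : ℂ) * v (μ - Finsupp.single i 1) := by
  induction v using Finsupp.induction_linear with
  | zero => simp
  | add v w hv hw => simp [hv, hw, mul_add]
  | single ν c =>
    classical
    simp only [raise, Finsupp.linearCombination_single, ket, Finsupp.smul_apply, smul_eq_mul,
      Finsupp.single_apply]
    by_cases h : ν + Finsupp.single i 1 = μ
    · subst h
      simp [mul_comm]
    · rw [if_neg h]
      by_cases h0 : μ i = 0
      · simp [h0]
      · rw [if_neg]
        · simp
        · rintro rfl
          apply h
          ext j
          by_cases hj : j = i
          · subst hj; simp; omega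
          · simp [Ne.symm hj]

lemma raise_ket (i : Fin n ⊕ Fin n) (μ : Occ n) :
    raise i (ket μ) = (Real.sqrt (μ i + 1) : ℂ) • ket (μ + Finsupp.single i 1) := by
  simp [raise, ket]

lemma lower_ket (i : Fin n ⊕ Fin n) (μ : Occ n) :
    lower i (ket μ) = (Real.sqrt (μ i) : ℂ) • ket (μ - Finsupp.single i 1) := by
  simp [lower, ket]

lemma lower_vacuum (i : Fin n ⊕ Fin n) : lower i (vacuum n) = 0 := by
  simp [vacuum, lower_ket]

lemma ofReal_sqrt_mul_self (k : ℕ) : (Real.sqrt k : ℂ) * (Real.sqrt k : ℂ) = k := by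
  rw [← Complex.ofReal_mul, Real.mul_self_sqrt (Nat.cast_nonneg k)]; simp

lemma ofReal_sqrt_succ_mul_self (k : ℕ) :
    (Real.sqrt (k + 1) : ℂ) * (Real.sqrt (k + 1) : ℂ) = k + 1 := by
  exact_mod_cast ofReal_sqrt_mul_self (k + 1)

lemma Occ.sub_add_single {μ : Occ n} {i : Fin n ⊕ Fin n} (h : μ i ≠ 0) :
    μ - Finsupp.single i 1 + Finsupp.single i 1 = μ :=
  tsub_add_cancel_of_le (by simpa [Finsupp.single_le_iff] using Nat.one_le_iff_ne_zero.2 h)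

lemma lower_raise_comm (i j : Fin n ⊕ Fin n) :
    lower i * raise j = raise j * lower i + if i = j then 1 else 0 := by
  ext1 μ
  ext1
  ext1 ν
  simp only [LinearMap.comp_apply, Module.End.mul_apply, LinearMap.add_apply, Finsupp.add_apply,
    lower_apply, raise_apply]
  generalize (Finsupp.lsingle μ : ℂ →ₗ[ℂ] Fock n) 1 = v
  split_ifs with h
  · subst h
    -- For equal indices the two orders have coefficients `ν i + 1` and `ν i`. The value zero is
    -- separated because `ν - e_i + e_i = ν` then fails.
    by_cases h0 : ν i = 0
    · simp [h0]
    · rw [Occ.sub_add_single h0]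
      obtain ⟨m, hm⟩ := Nat.exists_eq_succ_of_ne_zero h0
      have h1 := ofReal_sqrt_succ_mul_self (ν i)
      have h2 := ofReal_sqrt_succ_mul_self m
      simp only [Finsupp.single_eq_same, add_tsub_cancel_right,
        Finsupp.tsub_apply, hm, Module.End.one_apply] at *
      push_cast at *
      linear_combination v ν * h1 - v ν * h2
  · by_cases h0 : ν j = 0
    · simp [h0, h]
    · have : ν + Finsupp.single i 1 - Finsupp.single j 1
          = ν - Finsupp.single j 1 + Finsupp.single i 1 := by
        ext k
        simp only [Finsupp.tsub_apply, Finsupp.add_apply, Finsupp.single_apply]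
        split_ifs <;> simp_all
      simp [this, h, Ne.symm h]
      ring

lemma raise_raise_comm (i j : Fin n ⊕ Fin n) :
    (raise i * raise j : Module.End ℂ (Fock n)) = raise j * raise i := by
  rcases eq_or_ne i j with rfl | h
  · rfl
  ext1 μ
  ext1
  ext1 ν
  simp [raise_apply, Finsupp.single_apply, h, Ne.symm h, tsub_right_comm]
  ring_nf

lemma lower_lower_comm (i j : Fin n ⊕ Fin n) :
    (lower i * lower j : Module.End ℂ (Fock n)) = lower j * lower i := by
  rcases eq_or_ne i j with rfl | h
  · rfl
  ext1 μ
  ext1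
  ext1 ν
  simp [lower_apply, Finsupp.single_apply, h, Ne.symm h, add_right_comm]
  ring_nf

/-- The Fock space is generated from the vacuum by the creation operators. -/
lemma fock_induction {p : Fock n → Prop} (vac : p (vacuum n))
    (add : ∀ v w, p v → p w → p (v + w)) (smul : ∀ (c : ℂ) v, p v → p (c • v))
    (rai : ∀ i v, p v → p (raise i v)) (v : Fock n) : p v := by
  have key : ∀ μ ν : Occ n, p (ket ν) → p (ket (ν + μ)) := by
    intro μ
    induction μ using Finsupp.induction_linear with
    | zero => simp
    | add μ₁ μ₂ h₁ h₂ =>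
      intro ν hν
      rw [← add_assoc]
      exact h₂ _ (h₁ _ hν)
    | single i k =>
      intro ν hν
      induction k with
      | zero => simpa
      | succ k ih =>
        have h := smul (Real.sqrt ((ν + Finsupp.single i k) i + 1) : ℂ)⁻¹ _ (rai i _ ih)
        rw [raise_ket, smul_smul, inv_mul_cancel₀, one_smul, add_assoc,
          ← Finsupp.single_add] at h
        · exact h
        · exact_mod_cast (Real.sqrt_pos.2 (by positivity)).ne'
  induction v using Finsupp.induction_linear with
  | zero => simpa using smul 0 _ vac
  | add v w hv hw => exact add _ _ hv hw
  | single μ c =>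
    have := smul c _ (key μ 0 vac)
    simpa [ket] using this

/-! ### The inner product -/

lemma fockInner_apply (v w : Fock n) : fockInner n v w = v.sum fun μ c => conj c * w μ := rfl

lemma fockInner_ket_left (μ : Occ n) (w : Fock n) : fockInner n (ket μ) w = w μ := by
  simp [fockInner_apply, ket]

lemma fockInner_conj (v w : Fock n) : conj (fockInner n v w) = fockInner n w v := by
  classical
  rw [fockInner_apply, fockInner_apply,
    Finsupp.sum_of_support_subset v (Finset.subset_union_left (s₂ := w.support)) _ (by simp),
    Finsupp.sum_of_support_subset w (Finset.subset_union_right (s₁ := v.support)) _ (by simp)]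
  simp [mul_comm]

lemma fockInner_self (v : Fock n) :
    fockInner n v v = ((∑ μ ∈ v.support, ‖v μ‖ ^ 2 : ℝ) : ℂ) := by
  rw [fockInner_apply, Finsupp.sum]
  push_cast
  exact Finset.sum_congr rfl fun μ _ => Complex.conj_mul' _

lemma fockInner_self_re_nonneg (v : Fock n) : 0 ≤ (fockInner n v v).re := by
  rw [fockInner_self, Complex.ofReal_re]; positivity

lemma fockInner_self_re_pos {v : Fock n} (hv : v ≠ 0) : 0 < (fockInner n v v).re := by
  rw [fockInner_self, Complex.ofReal_re]
  obtain ⟨μ, hμ⟩ := Finsupp.support_nonempty_iff.2 hv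
  refine Finset.sum_pos' (fun _ _ => by positivity) ⟨μ, hμ, ?_⟩
  have : v μ ≠ 0 := by simpa using hμ
  positivity

lemma fockInner_raise_left (i : Fin n ⊕ Fin n) (v w : Fock n) :
    fockInner n (raise i v) w = fockInner n v (lower i w) := by
  induction v using Finsupp.induction_linear with
  | zero => simp
  | add v v' hv hv' => simp [hv, hv']
  | single μ c =>
    have : Finsupp.single μ c = c • ket μ := by simp [ket]
    rw [this, map_smul, map_smulₛₗ, map_smulₛₗ, raise_ket, map_smulₛₗ]
    simp [fockInner_ket_left, lower_apply]

lemma fockInner_lower_left (i : Fin n ⊕ Fin n) (v w : Fock n) :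
    fockInner n (lower i v) w = fockInner n v (raise i w) := by
  rw [← fockInner_conj, ← fockInner_raise_left, fockInner_conj]

lemma fockInner_vacuum_vacuum : fockInner n (vacuum n) (vacuum n) = 1 := by
  rw [vacuum, fockInner_ket_left]; simp [ket]

lemma vacuum_ne_zero : vacuum n ≠ 0 := by simp [vacuum, ket]

/-! ### The number of quanta -/

/-- The number operator counting the quanta of all the oscillators. -/
noncomputable def opN (n : ℕ) : Module.End ℂ (Fock n) := ∑ i, raise i * lower i

lemma raise_lower_apply (i : Fin n ⊕ Fin n) (v : Fock n) (μ : Occ n) :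
    raise i (lower i v) μ = μ i * v μ := by
  rw [raise_apply, lower_apply]
  by_cases h : μ i = 0
  · simp [h]
  · rw [Occ.sub_add_single h]
    obtain ⟨m, hm⟩ := Nat.exists_eq_succ_of_ne_zero h
    have h2 := ofReal_sqrt_succ_mul_self m
    simp [hm]
    linear_combination v μ * h2

lemma opN_apply (v : Fock n) (μ : Occ n) : opN n v μ = (∑ i, μ i : ℕ) * v μ := by
  simp only [opN, LinearMap.sum_apply, Finsupp.finsetSum_apply, Module.End.mul_apply,
    raise_lower_apply, Nat.cast_sum, Finset.sum_mul]

end SOStar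

namespace SOStar

/-! ### Quadratic expressions in oscillators -/

/-- The canonical commutation relations for creation operators `c` and annihilation
operators `d`. -/
structure CCR {L σ : Type} [Ring L] [DecidableEq σ] (c d : σ → L) : Prop where
  d_c : ∀ i j, d i * c j = c j * d i + if i = j then 1 else 0
  c_c : ∀ i j, c i * c j = c j * c i
  d_d : ∀ i j, d i * d j = d j * d i

section CCR

variable {L : Type} [Ring L]

lemma lie_mul_right (x y z : L) : ⁅x, y * z⁆ = ⁅x, y⁆ * z + y * ⁅x, z⁆ := by
  simp only [Ring.lie_def]; noncomm_ring

lemma lie_mul_left (x y z : L) : ⁅x * y, z⁆ = ⁅x, z⁆ * y + x * ⁅y, z⁆ := by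
  simp only [Ring.lie_def]; noncomm_ring

lemma lie_ite_one_left (p : Prop) [Decidable p] (x : L) : ⁅(if p then 1 else 0 : L), x⁆ = 0 := by
  split_ifs <;> simp [Ring.lie_def]

lemma lie_ite_one_right (p : Prop) [Decidable p] (x : L) : ⁅x, (if p then 1 else 0 : L)⁆ = 0 := by
  split_ifs <;> simp [Ring.lie_def]

section

variable {σ : Type} [DecidableEq σ] {c d : σ → L} (h : CCR c d)
include h

lemma CCR.lie_c_c (i j : σ) : ⁅c i, c j⁆ = 0 := by
  rw [Ring.lie_def, h.c_c, sub_self]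

lemma CCR.lie_d_d (i j : σ) : ⁅d i, d j⁆ = 0 := by
  rw [Ring.lie_def, h.d_d, sub_self]

lemma CCR.lie_d_c (i j : σ) : ⁅d i, c j⁆ = if i = j then 1 else 0 := by
  rw [Ring.lie_def, h.d_c, add_sub_cancel_left]

lemma CCR.lie_c_d (i j : σ) : ⁅c i, d j⁆ = if j = i then -1 else 0 := by
  rw [Ring.lie_def, h.d_c]
  split_ifs <;> simp

end

lemma CCR.lie_number_c {σ : Type} [DecidableEq σ] [Fintype σ] {c d : σ → L} (h : CCR c d) (j : σ) :
    ⁅∑ i, c i * d i, c j⁆ = c j := by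
  simp [sum_lie, lie_mul_left, h.lie_d_c, h.lie_c_c]

lemma CCR.lie_number_d {σ : Type} [DecidableEq σ] [Fintype σ] {c d : σ → L} (h : CCR c d) (j : σ) :
    ⁅∑ i, c i * d i, d j⁆ = - d j := by
  simp [sum_lie, lie_mul_left, h.lie_d_d, h.lie_c_d]

variable {n : ℕ} {c d : Fin n ⊕ Fin n → L} (h : CCR c d)
include h

/-- The bracket is a derivation in each slot, so a bracket of quadratic expressions expands into
products of oscillators weighted by Kronecker deltas. Only the comparison of deltas remains,
together with reordering of commuting factors. -/
lemma CCR.relations : Relations (n := n) (L := L)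
    (fun a b => c (.inl a) * d (.inl b) + c (.inr a) * d (.inr b) + if a = b then 1 else 0)
    (fun a b => d (.inr a) * d (.inl b) - d (.inl a) * d (.inr b))
    (fun a b => c (.inr a) * c (.inl b) - c (.inl a) * c (.inr b)) where
  E_E a b e f := by
    simp only [lie_mul_right, lie_mul_left, add_lie, lie_add, lie_ite_one_left, lie_ite_one_right,
      h.lie_c_c, h.lie_d_d, h.lie_c_d, h.lie_d_c, Sum.inl.injEq, Sum.inr.injEq, reduceCtorEq,
      if_false]
    by_cases h1 : b = e <;> by_cases h2 : a = f <;> simp [h1, h2, eq_comm] <;> abel_nf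
  E_Ft a b e f := by
    simp only [lie_mul_right, lie_mul_left, add_lie, lie_sub, lie_ite_one_left, h.lie_c_c,
      h.lie_d_c, Sum.inl.injEq, Sum.inr.injEq, reduceCtorEq, if_false, h.c_c (.inl _) (.inr _)]
    split_ifs <;> subst_vars <;> simp
  E_F a b e f := by
    simp only [lie_mul_right, lie_mul_left, add_lie, lie_sub, lie_ite_one_left,
      h.lie_d_d, h.lie_c_d, Sum.inl.injEq, Sum.inr.injEq, reduceCtorEq, if_false]
    split_ifs <;> subst_vars <;> simp_all [h.d_d (.inl _) (.inr _)] <;> abel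
  F_Ft a b e f := by
    simp only [lie_mul_right, lie_mul_left, sub_lie, lie_sub,
      h.lie_d_c, Sum.inl.injEq, Sum.inr.injEq, reduceCtorEq, if_false]
    split_ifs <;> subst_vars <;> simp_all [h.d_c] <;> abel
  F_F a b e f := by
    simp [lie_mul_right, lie_mul_left, sub_lie, lie_sub, h.lie_d_d]
  Ft_Ft a b e f := by
    simp [lie_mul_right, lie_mul_left, sub_lie, lie_sub, h.lie_c_c]
  F_antisymm a b := by
    rw [h.d_d (.inr b), h.d_d (.inl b)]; abel
  Ft_antisymm a b := by
    rw [h.c_c (.inr b), h.c_c (.inl b)]; abel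

/-- As a derivation, $J_+$ sends $B_a^\dagger\mapsto A_a^\dagger$ and $A_a\mapsto -B_a$ and kills
$A_a^\dagger$ and $B_a$; in each of the three expressions the resulting terms cancel. -/
lemma CCR.commute_raising (a b : Fin n) :
    Commute (∑ k, c (.inl k) * d (.inr k))
      (c (.inl a) * d (.inl b) + c (.inr a) * d (.inr b) + if a = b then 1 else 0) ∧
    Commute (∑ k, c (.inl k) * d (.inr k))
      (d (.inr a) * d (.inl b) - d (.inl a) * d (.inr b)) ∧
    Commute (∑ k, c (.inl k) * d (.inr k))
      (c (.inr a) * c (.inl b) - c (.inl a) * c (.inr b)) := by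
  refine ⟨?_, ?_, ?_⟩ <;> rw [commute_iff_lie_eq] <;>
    simp [sum_lie, lie_mul_left, lie_mul_right, h.lie_c_d, h.lie_d_c, h.lie_d_d, h.lie_c_c,
      lie_ite_one_right]

lemma CCR.commute_lowering (a b : Fin n) :
    Commute (∑ k, c (.inr k) * d (.inl k))
      (c (.inl a) * d (.inl b) + c (.inr a) * d (.inr b) + if a = b then 1 else 0) ∧
    Commute (∑ k, c (.inr k) * d (.inl k))
      (d (.inr a) * d (.inl b) - d (.inl a) * d (.inr b)) ∧
    Commute (∑ k, c (.inr k) * d (.inl k))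
      (c (.inr a) * c (.inl b) - c (.inl a) * c (.inr b)) := by
  refine ⟨?_, ?_, ?_⟩ <;> rw [commute_iff_lie_eq] <;>
    simp [sum_lie, lie_mul_left, lie_mul_right, h.lie_c_d, h.lie_d_c, h.lie_d_d, h.lie_c_c,
      lie_ite_one_right]

lemma CCR.commute_difference (a b : Fin n) :
    Commute (∑ k, (c (.inl k) * d (.inl k) - c (.inr k) * d (.inr k)))
      (c (.inl a) * d (.inl b) + c (.inr a) * d (.inr b) + if a = b then 1 else 0) ∧
    Commute (∑ k, (c (.inl k) * d (.inl k) - c (.inr k) * d (.inr k)))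
      (d (.inr a) * d (.inl b) - d (.inl a) * d (.inr b)) ∧
    Commute (∑ k, (c (.inl k) * d (.inl k) - c (.inr k) * d (.inr k)))
      (c (.inr a) * c (.inl b) - c (.inl a) * c (.inr b)) := by
  refine ⟨?_, ?_, ?_⟩ <;> rw [commute_iff_lie_eq] <;>
    simp [sum_lie, lie_mul_left, lie_mul_right, h.lie_c_d, h.lie_d_c, h.lie_d_d, h.lie_c_c,
      lie_ite_one_right]

/-- Capelli's identity. A product of two $2\times2$ determinants expands into four quartic sums,
equal in pairs after exchanging $a$ and $b$. Each pair is the normally ordered form of $N_BN_A$ or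
of $J_-J_+$. -/
lemma CCR.sum_sum_mul :
    ∑ a, ∑ b, (c (.inr a) * c (.inl b) - c (.inl a) * c (.inr b)) *
        (d (.inr a) * d (.inl b) - d (.inl a) * d (.inr b)) =
      2 * ((∑ a, c (.inr a) * d (.inr a)) * (∑ a, c (.inl a) * d (.inl a))
        - (∑ a, c (.inr a) * d (.inl a)) * (∑ a, c (.inl a) * d (.inr a))
        + ∑ a, c (.inr a) * d (.inr a)) := by
  have h1 : (∑ a : Fin n, c (.inr a) * d (.inr a)) * (∑ a, c (.inl a) * d (.inl a)) =
      ∑ a, ∑ b, c (.inr a) * c (.inl b) * (d (.inr a) * d (.inl b)) := by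
    rw [Finset.sum_mul_sum]
    refine Finset.sum_congr rfl fun a _ => Finset.sum_congr rfl fun b _ => ?_
    rw [mul_assoc, ← mul_assoc (d _), h.d_c]
    simp [mul_assoc]
  -- Here $A_a$ must pass $A_b^\dagger$, at the cost of $\delta_{ab}$. This contraction is the
  -- source of the $+1$ in $J(J+1)$; in `h1` the factors exchanged commute.
  have h2 : (∑ a : Fin n, c (.inr a) * d (.inl a)) * (∑ a, c (.inl a) * d (.inr a)) =
      ∑ a, ∑ b, c (.inr a) * c (.inl b) * (d (.inl a) * d (.inr b)) +
        ∑ a, c (.inr a) * d (.inr a) := by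
    rw [Finset.sum_mul_sum, ← Finset.sum_add_distrib]
    refine Finset.sum_congr rfl fun a _ => ?_
    have : c (.inr a) * d (.inr a) = ∑ b, if a = b then c (.inr a) * d (.inr b) else 0 := by
      simp
    rw [this, ← Finset.sum_add_distrib]
    refine Finset.sum_congr rfl fun b _ => ?_
    rw [mul_assoc, ← mul_assoc (d _), h.d_c]
    split_ifs <;> simp_all [mul_assoc, add_mul, mul_add]
  have h3 : ∑ a : Fin n, ∑ b, c (.inl a) * c (.inr b) * (d (.inl a) * d (.inr b)) =
      ∑ a, ∑ b, c (.inr a) * c (.inl b) * (d (.inr a) * d (.inl b)) := by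
    rw [Finset.sum_comm]
    simp only [h.c_c (.inl _) (.inr _), h.d_d (.inl _) (.inr _)]
  have h4 : ∑ a : Fin n, ∑ b, c (.inl a) * c (.inr b) * (d (.inr a) * d (.inl b)) =
      ∑ a, ∑ b, c (.inr a) * c (.inl b) * (d (.inl a) * d (.inr b)) := by
    rw [Finset.sum_comm]
    simp only [h.c_c (.inl _) (.inr _), h.d_d (.inl _) (.inr _)]
  rw [h1, h2]
  simp only [sub_mul, mul_sub, Finset.sum_sub_distrib, h3, h4]
  noncomm_ring

end CCR

/-! ### The quadratic operators on the Fock space -/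

variable {n : ℕ}

lemma ccr : CCR (L := Module.End ℂ (Fock n)) raise lower :=
  ⟨lower_raise_comm, raise_raise_comm, lower_lower_comm⟩

lemma raise_raise_apply (i j : Fin n ⊕ Fin n) (v : Fock n) :
    raise i (raise j v) = raise j (raise i v) :=
  congr($(raise_raise_comm i j) v)

lemma lower_lower_apply (i j : Fin n ⊕ Fin n) (v : Fock n) :
    lower i (lower j v) = lower j (lower i v) :=
  congr($(lower_lower_comm i j) v)

lemma lower_raise_apply (i j : Fin n ⊕ Fin n) (v : Fock n) :
    lower i (raise j v) = raise j (lower i v) + if i = j then v else 0 := by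
  refine congr($(lower_raise_comm i j) v).trans ?_
  split_ifs <;> simp

lemma opE_opF_opFt_relations : Relations (n := n) (L := Module.End ℂ (Fock n)) opE opF opFt :=
  ccr.relations

lemma opJz_eq : opJz n = (1 / 2 : ℂ) • ∑ k : Fin n, (opAd k * opA k - opBd k * opB k) := by
  rw [opJz, Finset.smul_sum]

lemma opJz_eq_sub :
    opJz n = (1 / 2 : ℂ) • (∑ k : Fin n, opAd k * opA k - ∑ k : Fin n, opBd k * opB k) := by
  rw [opJz_eq]
  congr 1
  exact Finset.sum_sub_distrib (fun k => (opAd k * opA k : Module.End ℂ (Fock n))) _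

lemma isScalarOp_opE (a b : Fin n) : IsScalarOp (opE a b) :=
  ⟨opJz_eq (n := n) ▸ (ccr.commute_difference a b).1.smul_left _, (ccr.commute_raising a b).1,
    (ccr.commute_lowering a b).1⟩

lemma isScalarOp_opF (a b : Fin n) : IsScalarOp (opF a b) :=
  ⟨opJz_eq (n := n) ▸ (ccr.commute_difference a b).2.1.smul_left _, (ccr.commute_raising a b).2.1,
    (ccr.commute_lowering a b).2.1⟩

lemma isScalarOp_opFt (a b : Fin n) : IsScalarOp (opFt a b) :=
  ⟨opJz_eq (n := n) ▸ (ccr.commute_difference a b).2.2.smul_left _, (ccr.commute_raising a b).2.2,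
    (ccr.commute_lowering a b).2.2⟩

lemma fockInner_opE_left (a b : Fin n) (v w : Fock n) :
    fockInner n (opE a b v) w = fockInner n v (opE b a w) := by
  simp only [opE, opA, opB, opAd, opBd, LinearMap.add_apply, Module.End.mul_apply, map_add,
    fockInner_raise_left, fockInner_lower_left, eq_comm (a := a)]
  split_ifs <;> simp

lemma fockInner_opF_left (a b : Fin n) (v w : Fock n) :
    fockInner n (opF a b v) w = fockInner n v (opFt a b w) := by
  simp only [opF, opFt, opA, opB, opAd, opBd, LinearMap.sub_apply, Module.End.mul_apply, map_sub,
    fockInner_lower_left]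
  rw [raise_raise_apply (.inl b), raise_raise_apply (.inr b)]

lemma opN_raise (i : Fin n ⊕ Fin n) (v : Fock n) :
    opN n (raise i v) = raise i (opN n v) + raise i v := by
  have := (ccr (n := n)).lie_number_c i
  rw [Ring.lie_def, sub_eq_iff_eq_add'] at this
  exact congr($this v)

lemma opN_lower (i : Fin n ⊕ Fin n) (v : Fock n) :
    opN n (lower i v) = lower i (opN n v) - lower i v := by
  have := (ccr (n := n)).lie_number_d i
  rw [Ring.lie_def, sub_eq_iff_eq_add', ← sub_eq_add_neg] at this
  exact congr($this v)

lemma opN_opE (a b : Fin n) (v : Fock n) : opN n (opE a b v) = opE a b (opN n v) := by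
  simp only [opE, opA, opB, opAd, opBd, LinearMap.add_apply, Module.End.mul_apply, map_add,
    opN_raise, opN_lower, map_sub]
  split_ifs <;> simp

lemma opN_opF (a b : Fin n) (v : Fock n) :
    opN n (opF a b v) = opF a b (opN n v) - (2 : ℂ) • opF a b v := by
  simp only [opF, opA, opB, LinearMap.sub_apply, Module.End.mul_apply,
    opN_lower, map_sub, two_smul]
  abel

lemma opN_opFt (a b : Fin n) (v : Fock n) :
    opN n (opFt a b v) = opFt a b (opN n v) + (2 : ℂ) • opFt a b v := by
  simp only [opFt, opAd, opBd, LinearMap.sub_apply, Module.End.mul_apply, map_add,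
    opN_raise, map_sub, two_smul]
  abel

lemma opE_vacuum (a b : Fin n) : opE a b (vacuum n) = if a = b then vacuum n else 0 := by
  simp only [opE, opA, opB, opAd, opBd, LinearMap.add_apply, Module.End.mul_apply,
    lower_vacuum, map_zero, zero_add]
  split_ifs <;> simp

lemma opF_vacuum (a b : Fin n) : opF a b (vacuum n) = 0 := by
  simp only [opF, opA, opB, LinearMap.sub_apply, Module.End.mul_apply,
    lower_vacuum, map_zero, sub_zero]

/-! ### The intertwiner spaces -/

lemma map_mem_invariants {T : Module.End ℂ (Fock n)} (hT : IsScalarOp T) {v : Fock n}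
    (hv : v ∈ invariants n) : T v ∈ invariants n := by
  obtain ⟨⟨h1, h2⟩, h3⟩ := hv
  obtain ⟨t1, t2, t3⟩ := hT
  have h1 : opJz n v = 0 := h1
  have h2 : opJp n v = 0 := h2
  have h3 : opJm n v = 0 := h3
  refine ⟨⟨?_, ?_⟩, ?_⟩
  · exact (congr($(t1.eq) v)).trans (by simp [h1])
  · exact (congr($(t2.eq) v)).trans (by simp [h2])
  · exact (congr($(t3.eq) v)).trans (by simp [h3])

lemma mem_invariants_iff {v : Fock n} :
    v ∈ invariants n ↔ opJz n v = 0 ∧ opJp n v = 0 ∧ opJm n v = 0 := by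
  simp [invariants, and_assoc]

lemma opJz_apply (v : Fock n) (μ : Occ n) :
    opJz n v μ = (1 / 2 : ℂ) * (∑ a, (μ (.inl a) : ℂ) - ∑ a, (μ (.inr a) : ℂ)) * v μ := by
  simp only [opJz_eq_sub, LinearMap.smul_apply, LinearMap.sub_apply, LinearMap.sum_apply,
    Module.End.mul_apply, opAd, opA, opBd, opB, Finsupp.smul_apply, Finsupp.sub_apply,
    Finsupp.finsetSum_apply, raise_lower_apply, smul_eq_mul, mul_assoc, sub_mul, Finset.sum_mul]

lemma mem_legSpace_iff {k : Fin n → ℕ} {v : Fock n} :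
    v ∈ legSpace k ↔ ∀ μ, v μ ≠ 0 → ∀ a, μ (.inl a) + μ (.inr a) = k a := by
  have : legSpace k = Finsupp.supported ℂ ℂ
      {μ : Occ n | ∀ a, μ (.inl a) + μ (.inr a) = k a} := by
    rw [Finsupp.supported_eq_span_single, legSpace]
    congr 1
    ext v
    simp [ket, eq_comm]
  rw [this, Finsupp.mem_supported]
  simp [Set.subset_def]

/-- The number of quanta on each leg. -/
def legs (μ : Occ n) : Fin n → ℕ := fun a => μ (.inl a) + μ (.inr a)

/-- Both oscillators belong to leg `a`, so moving a quantum between them does not change the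
occupation of any leg. Each term of $J_\pm$ has this form, so $J_\pm$ commute with the projections
onto fixed spins. -/
lemma raise_lower_filter (a : Fin n) (p q : Fin n ⊕ Fin n) (hp : p = .inl a ∨ p = .inr a)
    (hq : q = .inl a ∨ q = .inr a) (k : Fin n → ℕ) (v : Fock n) :
    raise p (lower q (v.filter fun μ => legs μ = k)) =
      (raise p (lower q v)).filter fun μ => legs μ = k := by
  classical
  ext μ
  rw [raise_apply, lower_apply, Finsupp.filter_apply, Finsupp.filter_apply, raise_apply,
    lower_apply]
  by_cases h0 : μ p = 0
  · simp [h0]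
  · have : legs (μ - Finsupp.single p 1 + Finsupp.single q 1) = legs μ := by
      funext b
      obtain ⟨m, hm⟩ := Nat.exists_eq_succ_of_ne_zero h0
      by_cases hb : b = a
      · subst hb
        rcases hp with rfl | rfl <;> rcases hq with rfl | rfl <;> simp [legs, hm]  <;> omega
      · rcases hp with rfl | rfl <;> rcases hq with rfl | rfl <;> simp [legs, hb]
    rw [this]
    split_ifs <;> simp

lemma filter_mem_invariants (k : Fin n → ℕ) {v : Fock n} (hv : v ∈ invariants n) :
    (v.filter fun μ => legs μ = k) ∈ invariants n := by
  have add (f g : Fock n) : (f + g).filter (fun μ => legs μ = k) =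
    f.filter (fun μ => legs μ = k) + g.filter (fun μ => legs μ = k) := Finsupp.filter_add
  rw [mem_invariants_iff] at hv ⊢
  obtain ⟨h1, h2, h3⟩ := hv
  refine ⟨?_, ?_, ?_⟩
  · ext μ
    have := congr($h1 μ)
    rw [opJz_apply] at this ⊢
    classical
    rw [Finsupp.filter_apply]
    split_ifs
    · exact this
    · simp
  · have : opJp n (v.filter fun μ => legs μ = k) = (opJp n v).filter fun μ => legs μ = k := by
      simp only [opJp, LinearMap.sum_apply, Module.End.mul_apply, opAd, opB]
      rw [Finsupp.filter_sum]
      exact Finset.sum_congr rfl fun a _ => raise_lower_filter a _ _ (by simp) (by simp) _ _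
    rw [this, h2, Finsupp.filter_zero]
  · have : opJm n (v.filter fun μ => legs μ = k) = (opJm n v).filter fun μ => legs μ = k := by
      simp only [opJm, LinearMap.sum_apply, Module.End.mul_apply, opBd, opA]
      rw [Finsupp.filter_sum]
      exact Finset.sum_congr rfl fun a _ => raise_lower_filter a _ _ (by simp) (by simp) _ _
    rw [this, h3, Finsupp.filter_zero]

lemma sum_filter_legs (v : Fock n) :
    ∑ k ∈ v.support.image legs, v.filter (fun μ => legs μ = k) = v := by
  classical
  ext μ
  rw [Finsupp.finsetSum_apply]
  simp only [Finsupp.filter_apply]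
  rw [Finset.sum_ite_eq]
  split_ifs with h
  · rfl
  · by_contra h0
    exact h (Finset.mem_image_of_mem _ (by simpa using Ne.symm h0))

lemma opN_eq_smul_iff {d : ℕ} {v : Fock n} :
    opN n v = (d : ℂ) • v ↔ ∀ μ, v μ ≠ 0 → ∑ i, μ i = d := by
  constructor
  · intro h μ hμ
    have := congr($h μ)
    rw [opN_apply, Finsupp.smul_apply, smul_eq_mul] at this
    exact_mod_cast mul_right_cancel₀ hμ this
  · intro h
    ext μ
    rw [opN_apply, Finsupp.smul_apply, smul_eq_mul]
    by_cases hμ : v μ = 0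
    · simp [hμ]
    · rw [h μ hμ]

lemma sum_legs (μ : Occ n) : ∑ a, legs μ a = ∑ i, μ i := by
  simp [legs, Finset.sum_add_distrib]

lemma filter_mem_legSpace (k : Fin n → ℕ) (v : Fock n) :
    (v.filter fun μ => legs μ = k) ∈ legSpace k := by
  rw [mem_legSpace_iff]
  intro μ hμ a
  classical
  rw [Finsupp.filter_apply] at hμ
  split_ifs at hμ with h
  · exact congr($h a)
  · exact absurd rfl hμ

/-- The components of an invariant vector with fixed spins are again invariant, so a sum over spins
amounts to an eigenvalue equation for the number operator. In this form stability under
$E,F,\widetilde F$ is a matter of commutators. -/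
lemma mem_areaSpace_iff {J : ℕ} {v : Fock n} :
    v ∈ areaSpace n J ↔ v ∈ invariants n ∧ opN n v = (2 * J : ℂ) • v := by
  constructor
  · have : areaSpace n J ≤ invariants n ⊓ LinearMap.ker (opN n - (2 * J : ℂ) • 1) := by
      refine iSup_le fun ⟨k, hk⟩ v ⟨h1, h2⟩ => ⟨h2, ?_⟩
      have : opN n v = ((2 * J : ℕ) : ℂ) • v := by
        rw [opN_eq_smul_iff]
        intro μ hμ
        rw [← sum_legs, ← hk]
        exact Finset.sum_congr rfl fun a _ => (mem_legSpace_iff.1 h1) μ hμ a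
      simp [this]
    intro h
    have := this h
    simpa [sub_eq_zero] using this
  · rintro ⟨h1, h2⟩
    have h2 : opN n v = ((2 * J : ℕ) : ℂ) • v := by simpa using h2
    rw [opN_eq_smul_iff] at h2
    rw [← sum_filter_legs v]
    refine Submodule.sum_mem _ fun k hk => ?_
    obtain ⟨μ, hμ, rfl⟩ := Finset.mem_image.1 hk
    refine Submodule.mem_iSup_of_mem (⟨legs μ, ?_⟩ : {k : Fin n → ℕ // ∑ a, k a = 2 * J})
      ⟨filter_mem_legSpace _ _, filter_mem_invariants _ h1⟩
    rw [sum_legs]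
    exact h2 μ (by simpa using hμ)

lemma areaSpace_le_invariants (J : ℕ) : areaSpace n J ≤ invariants n :=
  fun _ hv => (mem_areaSpace_iff.1 hv).1

lemma intertwinerSpace_eq : intertwinerSpace n = invariants n := by
  refine le_antisymm (iSup_le areaSpace_le_invariants) fun v hv => ?_
  rw [← sum_filter_legs v]
  refine Submodule.sum_mem _ fun k hk => ?_
  obtain ⟨μ, hμ, rfl⟩ := Finset.mem_image.1 hk
  have h0 : v μ ≠ 0 := by simpa using hμ
  have h1 := congr($((mem_invariants_iff.1 hv).1) μ)
  rw [opJz_apply] at h1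
  -- $J_zv=0$ gives $N_A=N_B$ on each occupied basis vector; the number of quanta is even, and the
  -- area is the integer $N_A$.
  have h2 : ∑ a, μ (.inl a) = ∑ a, μ (.inr a) := by
    simp [h0, sub_eq_zero] at h1
    exact_mod_cast h1
  refine Submodule.mem_iSup_of_mem (∑ a, μ (.inl a)) <|
    Submodule.mem_iSup_of_mem (⟨legs μ, ?_⟩ : {k : Fin n → ℕ // ∑ a, k a = _})
      ⟨filter_mem_legSpace _ _, filter_mem_invariants _ hv⟩
  rw [sum_legs, Fintype.sum_sum_type, ← h2, two_mul]

/-- Capelli's identity on the invariant vectors. -/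
lemma sum_opFt_opF_apply {v : Fock n} (hv : v ∈ invariants n) (μ : Occ n) :
    (∑ a : Fin n, ∑ b : Fin n, opFt a b (opF a b v)) μ =
      2 * ((∑ a, μ (.inl a) : ℕ) * ((∑ a, μ (.inl a) : ℕ) + 1)) * v μ := by
  obtain ⟨h1, h2, -⟩ := mem_invariants_iff.1 hv
  have key := congr($(ccr.sum_sum_mul (n := n)) v)
  have e : ∑ a : Fin n, ∑ b : Fin n, opFt a b (opF a b v) =
      (∑ a : Fin n, ∑ b : Fin n, opFt a b * opF a b) v := by
    simp [LinearMap.sum_apply]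
  rw [e]
  refine (congr($key μ)).trans ?_
  change (2 * ((∑ a : Fin n, opBd a * opB a) * (∑ a, opAd a * opA a) - opJm n * opJp n
    + (∑ a : Fin n, opBd a * opB a)) : Module.End ℂ (Fock n)) v μ = _
  have h1 := congr($h1 μ)
  rw [opJz_apply] at h1
  rw [two_mul]
  simp only [LinearMap.add_apply, LinearMap.sub_apply, Module.End.mul_apply, h2, map_zero,
    LinearMap.sum_apply, opAd, opA, opBd, opB, Finsupp.finsetSum_apply, raise_lower_apply,
    Finsupp.add_apply, Finsupp.sub_apply, Finsupp.zero_apply, ← Finset.sum_mul] at h1 ⊢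
  push_cast
  -- The two sides differ by $2(N_A+1)(N_B-N_A)$, a multiple of the eigenvalue $\tfrac12(N_A-N_B)$
  -- of $J_z$.
  linear_combination -4 * (∑ a, (μ (.inl a) : ℂ) + 1) * h1

lemma sum_opFt_opF {J : ℕ} {v : Fock n} (hv : v ∈ areaSpace n J) :
    ∑ a : Fin n, ∑ b : Fin n, opFt a b (opF a b v) = (2 * (J * (J + 1)) : ℂ) • v := by
  obtain ⟨h1, h2⟩ := mem_areaSpace_iff.1 hv
  have h2 : opN n v = ((2 * J : ℕ) : ℂ) • v := by simpa using h2
  rw [opN_eq_smul_iff] at h2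
  ext μ
  rw [sum_opFt_opF_apply h1, Finsupp.smul_apply, smul_eq_mul]
  by_cases h0 : v μ = 0
  · simp [h0]
  · have h2 := h2 μ h0
    have h3 := congr($((mem_invariants_iff.1 h1).1) μ)
    rw [opJz_apply] at h3
    have h4 : ∑ a, μ (.inl a) = ∑ a, μ (.inr a) := by
      simp [h0, sub_eq_zero] at h3
      exact_mod_cast h3
    rw [Fintype.sum_sum_type] at h2
    have : ∑ a, μ (.inl a) = J := by omega
    rw [this]

lemma opE_mem_areaSpace {J : ℕ} (a b : Fin n) {v : Fock n} (hv : v ∈ areaSpace n J) :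
    opE a b v ∈ areaSpace n J := by
  rw [mem_areaSpace_iff] at hv ⊢
  exact ⟨map_mem_invariants (isScalarOp_opE a b) hv.1, by rw [opN_opE, hv.2, map_smul]⟩

lemma opFt_mem_areaSpace {J : ℕ} (a b : Fin n) {v : Fock n} (hv : v ∈ areaSpace n J) :
    opFt a b v ∈ areaSpace n (J + 1) := by
  rw [mem_areaSpace_iff] at hv ⊢
  refine ⟨map_mem_invariants (isScalarOp_opFt a b) hv.1, ?_⟩
  rw [opN_opFt, hv.2, map_smul]
  push_cast
  module

lemma opF_mem_areaSpace {J : ℕ} (a b : Fin n) {v : Fock n} (hv : v ∈ areaSpace n (J + 1)) :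
    opF a b v ∈ areaSpace n J := by
  rw [mem_areaSpace_iff] at hv ⊢
  refine ⟨map_mem_invariants (isScalarOp_opF a b) hv.1, ?_⟩
  rw [opN_opF, hv.2, map_smul]
  push_cast
  module

lemma vacuum_mem_areaSpace : vacuum n ∈ areaSpace n 0 := by
  rw [mem_areaSpace_iff, mem_invariants_iff]
  simp [opJz, opJp, opJm, opN, LinearMap.sum_apply, opA, opB, lower_vacuum]

lemma eq_smul_vacuum {v : Fock n} (hv : v ∈ areaSpace n 0) : ∃ c : ℂ, v = c • vacuum n := by
  have h : opN n v = ((0 : ℕ) : ℂ) • v := by simpa using (mem_areaSpace_iff.1 hv).2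
  rw [opN_eq_smul_iff] at h
  refine ⟨v 0, ?_⟩
  ext μ
  by_cases hμ : μ = 0
  · simp [hμ, vacuum, ket]
  · have : v μ = 0 := by
      by_contra h0
      apply hμ
      ext i
      simpa using Finset.sum_eq_zero_iff.1 (h μ h0) i
    simp [vacuum, ket, this, Ne.symm hμ]

/-! ### Irreducibility of the space of all intertwiners -/

/-- By Capelli's identity $N_A(N_A+1)$ vanishes at every occupied basis vector, hence $N_A=0$, and
$N_B=N_A$ because $J_zv=0$. -/
lemma eq_smul_vacuum_of_opF {v : Fock n} (hv : v ∈ invariants n) (h : ∀ a b, opF a b v = 0) :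
    ∃ c : ℂ, v = c • vacuum n := by
  apply eq_smul_vacuum
  rw [mem_areaSpace_iff]
  refine ⟨hv, ?_⟩
  ext μ
  have h1 := sum_opFt_opF_apply hv μ
  simp only [h, map_zero, Finset.sum_const_zero, Finsupp.zero_apply] at h1
  have h3 := congr($((mem_invariants_iff.1 hv).1) μ)
  rw [opJz_apply] at h3
  rw [opN_apply, Fintype.sum_sum_type]
  by_cases h0 : v μ = 0
  · simp [h0]
  · have h4 : ∑ a, μ (.inl a) = ∑ a, μ (.inr a) := by
      simp [h0, sub_eq_zero] at h3
      exact_mod_cast h3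
    have h5 : ∑ a, μ (.inl a) = 0 := by
      by_contra h5
      exact mul_ne_zero (mul_ne_zero two_ne_zero (mul_ne_zero (Nat.cast_ne_zero.2 h5)
        (Nat.cast_add_one_ne_zero _))) h0 h1.symm
    simp [← h4, h5]

/-- All the occupied basis vectors have weighted number of quanta less than `m`. -/
def BoundedBy (w : Fin n ⊕ Fin n → ℕ) (m : ℕ) (v : Fock n) : Prop :=
  ∀ μ, v μ ≠ 0 → ∑ i, w i * μ i < m

lemma exists_boundedBy (w : Fin n ⊕ Fin n → ℕ) (v : Fock n) : ∃ m, BoundedBy w m v := by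
  refine ⟨v.support.sup (fun μ => ∑ i, w i * μ i) + 1, fun μ hμ => ?_⟩
  exact Nat.lt_succ_of_le (Finset.le_sup (f := fun μ : Occ n => ∑ i, w i * μ i) (by simpa using hμ))

lemma sum_mul_add_single (w : Fin n ⊕ Fin n → ℕ) (μ : Occ n) (i : Fin n ⊕ Fin n) :
    ∑ j, w j * (μ + Finsupp.single i 1 : Occ n) j = ∑ j, w j * μ j + w i := by
  simp only [Finsupp.add_apply, mul_add, Finset.sum_add_distrib, Finsupp.single_apply]
  simp only [mul_ite, mul_one, mul_zero, Finset.sum_ite_eq, Finset.mem_univ, if_true]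

lemma BoundedBy.lower {w : Fin n ⊕ Fin n → ℕ} {m : ℕ} {v : Fock n} (h : BoundedBy w m v)
    (i : Fin n ⊕ Fin n) : BoundedBy w (m - w i) (lower i v) := by
  intro μ hμ
  rw [lower_apply] at hμ
  have := h _ (right_ne_zero_of_mul hμ)
  rw [sum_mul_add_single] at this
  omega

lemma BoundedBy.raise {w : Fin n ⊕ Fin n → ℕ} {m : ℕ} {v : Fock n} (h : BoundedBy w m v)
    (i : Fin n ⊕ Fin n) : BoundedBy w (m + w i) (raise i v) := by
  intro μ hμ
  rw [raise_apply] at hμ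
  have h0 : μ i ≠ 0 := fun h0 => by simp [h0] at hμ
  have := h _ (right_ne_zero_of_mul hμ)
  rw [← Occ.sub_add_single h0, sum_mul_add_single]
  omega

lemma BoundedBy.add {w : Fin n ⊕ Fin n → ℕ} {m : ℕ} {v v' : Fock n} (h : BoundedBy w m v)
    (h' : BoundedBy w m v') : BoundedBy w m (v + v') := by
  intro μ hμ
  by_cases h0 : v μ = 0
  · exact h' μ (by simpa [h0] using hμ)
  · exact h μ h0

lemma BoundedBy.sub {w : Fin n ⊕ Fin n → ℕ} {m : ℕ} {v v' : Fock n} (h : BoundedBy w m v)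
    (h' : BoundedBy w m v') : BoundedBy w m (v - v') := by
  intro μ hμ
  by_cases h0 : v μ = 0
  · exact h' μ (by simpa [h0] using hμ)
  · exact h μ h0

lemma BoundedBy.mono {w : Fin n ⊕ Fin n → ℕ} {m m' : ℕ} {v : Fock n} (h : BoundedBy w m v)
    (hm : m ≤ m') : BoundedBy w m' v := fun μ hμ => (h μ hμ).trans_le hm

lemma BoundedBy.eq_zero {w : Fin n ⊕ Fin n → ℕ} {v : Fock n} (h : BoundedBy w 0 v) : v = 0 := by
  ext μ
  by_contra h0
  exact absurd (h μ h0) (by simp)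

/-- Each $F_{ab}$ removes two quanta. Applying some $F_{ab}$ with nonzero result as long as one
exists must stop, and it stops at a nonzero multiple of the vacuum. -/
lemma vacuum_mem_of_stable {W : Submodule ℂ (Fock n)} (hW : W ≤ invariants n)
    (hF : ∀ (a b : Fin n), ∀ v ∈ W, opF a b v ∈ W) (h0 : W ≠ ⊥) : vacuum n ∈ W := by
  have key : ∀ (m : ℕ) (v : Fock n), v ∈ W → v ≠ 0 → BoundedBy (fun _ => 1) m v →
      vacuum n ∈ W := by
    intro m
    induction m with
    | zero => exact fun v _ hv h => absurd h.eq_zero hv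
    | succ m ih =>
      intro v hvW hv hb
      by_cases h : ∀ a b, opF a b v = 0
      · obtain ⟨c, rfl⟩ := eq_smul_vacuum_of_opF (hW hvW) h
        exact (W.smul_mem_iff (left_ne_zero_of_smul hv)).1 hvW
      · push Not at h
        obtain ⟨a, b, hab⟩ := h
        exact ih _ (hF a b v hvW) hab
          ((((hb.lower _).lower _).sub ((hb.lower _).lower _)).mono (by omega))
  obtain ⟨v, hv, hv0⟩ := W.exists_mem_ne_zero_of_ne_bot h0
  obtain ⟨m, hm⟩ := exists_boundedBy (fun _ => 1) v
  exact key m v hv hv0 hm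

/-- Capelli's identity writes a nonzero multiple of a vector of area $J+1$ as $\sum\widetilde
F_{ab}(F_{ab}v)$, where $F_{ab}v$ has area $J$. -/
lemma areaSpace_le_of_vacuum_mem {W : Submodule ℂ (Fock n)}
    (hFt : ∀ (a b : Fin n), ∀ v ∈ W, opFt a b v ∈ W) (h0 : vacuum n ∈ W) (J : ℕ) :
    areaSpace n J ≤ W := by
  induction J with
  | zero =>
    intro v hv
    obtain ⟨c, rfl⟩ := eq_smul_vacuum hv
    exact W.smul_mem c h0
  | succ J ih =>
    intro v hv
    have h := sum_opFt_opF hv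
    have hc : (2 * ((J + 1 : ℕ) * ((J + 1 : ℕ) + 1)) : ℂ) ≠ 0 := by
      exact_mod_cast (by positivity : 2 * ((J + 1) * ((J + 1) + 1)) ≠ 0)
    rw [← W.smul_mem_iff hc, ← h]
    exact W.sum_mem fun a _ => W.sum_mem fun b _ => hFt a b _ (ih (opF_mem_areaSpace a b hv))

lemma intertwinerSpace_irreducible {W : Submodule ℂ (Fock n)} (hW : W ≤ intertwinerSpace n)
    (h : ∀ (a b : Fin n), ∀ v ∈ W, opF a b v ∈ W ∧ opFt a b v ∈ W) :
    W = ⊥ ∨ W = intertwinerSpace n := by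
  refine or_iff_not_imp_left.2 fun h0 => le_antisymm hW <| iSup_le fun J => ?_
  exact areaSpace_le_of_vacuum_mem (fun a b v hv => (h a b v hv).2)
    (vacuum_mem_of_stable (intertwinerSpace_eq (n := n) ▸ hW) (fun a b v hv => (h a b v hv).1) h0) J

/-! ### Highest weight vectors of fixed total area -/

lemma opF_opFt_apply {p q : Fin n} (hpq : p ≠ q) (v : Fock n) :
    opF p q (opFt p q v) = opFt p q (opF p q v) + (opE p p v + opE q q v) := by
  have h := (opE_opF_opFt_relations (n := n)).F_Ft p q p q
  rw [Ring.lie_def, sub_eq_iff_eq_add'] at h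
  refine (congr($h v)).trans ?_
  simp [hpq, hpq.symm]

lemma opE_opFt_apply (a b p q : Fin n) (v : Fock n) :
    opE a b (opFt p q v) = opFt p q (opE a b v) + ((if b = p then opFt a q v else 0)
      - (if b = q then opFt a p v else 0)) := by
  have h := (opE_opF_opFt_relations (n := n)).E_Ft a b p q
  rw [Ring.lie_def, sub_eq_iff_eq_add'] at h
  refine (congr($h v)).trans ?_
  split_ifs <;> rfl

lemma opFt_self (a : Fin n) : opFt a a = 0 := by
  exact (sub_eq_zero (G := Module.End ℂ (Fock n))).2 (raise_raise_comm _ _)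

lemma opF_self (a : Fin n) : opF a a = 0 := by
  exact (sub_eq_zero (G := Module.End ℂ (Fock n))).2 (lower_lower_comm _ _)

lemma fockInner_smul_left (c : ℂ) (v w : Fock n) :
    fockInner n (c • v) w = conj c * fockInner n v w := by
  rw [map_smulₛₗ, LinearMap.smul_apply, smul_eq_mul]

lemma fockInner_smul_right (c : ℂ) (v w : Fock n) :
    fockInner n v (c • w) = c * fockInner n v w := by
  rw [map_smul, smul_eq_mul]

lemma fockInner_opE_self_re (a : Fin n) (v : Fock n) :
    (fockInner n v v).re ≤ (fockInner n v (opE a a v)).re := by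
  simp only [opE, opA, opB, opAd, opBd, LinearMap.add_apply, Module.End.mul_apply, map_add,
    ← fockInner_lower_left, if_true, Module.End.one_apply, Complex.add_re]
  have h1 := fockInner_self_re_nonneg (lower (.inl a) v)
  have h2 := fockInner_self_re_nonneg (lower (.inr a) v)
  linarith

/-- Pairing $F\widetilde F=\widetilde FF+E_{pp}+E_{qq}$ with $v$ gives $\|F_{pq}v\|^2$ plus the
expectations of $E_{pp}$ and $E_{qq}$. Each of the latter is at least $\|v\|^2$, since $E_{aa}$ is a
number operator plus one. -/
lemma eq_zero_of_opFt_eq_zero {p q : Fin n} (hpq : p ≠ q) {v : Fock n} (h : opFt p q v = 0) :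
    v = 0 := by
  by_contra hv
  have h1 := congr((fockInner n v $(opF_opFt_apply hpq v)).re)
  rw [h, map_add, map_add, ← fockInner_opF_left] at h1
  simp only [map_zero, Complex.add_re, Complex.zero_re] at h1
  have h2 := fockInner_self_re_nonneg (opF p q v)
  have h3 := fockInner_opE_self_re p v
  have h4 := fockInner_opE_self_re q v
  have h5 := fockInner_self_re_pos hv
  linarith

/-- Cramer's rule: the hypotheses are two linear equations for $A_bv$ and $B_bv$ whose coefficients
are commuting creation operators. Eliminating one unknown leaves $\widetilde F_{pq}$ applied to the
other. -/
lemma opA_eq_zero_and_opB_eq_zero {p q b : Fin n} (hpq : p ≠ q) (hbp : b ≠ p) (hbq : b ≠ q)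
    {v : Fock n} (hp : opE p b v = 0) (hq : opE q b v = 0) : opA b v = 0 ∧ opB b v = 0 := by
  simp only [opE, if_neg hbp.symm, if_neg hbq.symm, add_zero, LinearMap.add_apply,
    Module.End.mul_apply] at hp hq
  constructor <;> apply eq_zero_of_opFt_eq_zero hpq
  · have h1 := congr(opBd q $hp)
    have h2 := congr(opBd p $hq)
    simp only [opAd, opBd, map_add, map_zero] at h1 h2
    simp only [opFt, opAd, opBd, LinearMap.sub_apply, Module.End.mul_apply]
    rw [raise_raise_apply (.inr q) (.inr p)] at h1
    rw [raise_raise_apply (.inl p) (.inr q)]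
    linear_combination (norm := module) h2 - h1
  · have h1 := congr(opAd q $hp)
    have h2 := congr(opAd p $hq)
    simp only [opAd, opBd, map_add, map_zero] at h1 h2
    simp only [opFt, opAd, opBd, LinearMap.sub_apply, Module.End.mul_apply]
    rw [raise_raise_apply (.inl q) (.inl p), raise_raise_apply (.inl q) (.inr p)] at h1
    linear_combination (norm := module) h1 - h2

/-- If only the legs $p,q$ are occupied, every $F_{ab}v$ with $\{a,b\}\ne\{p,q\}$ vanishes.
Capelli's identity then recovers $v$ from $\widetilde F_{pq}F_{pq}v$, and $F_{pq}v$ satisfies the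
same hypotheses with the area lowered by one. -/
lemma exists_eq_smul_opFt_pow {p q : Fin n} (hpq : p ≠ q) {J : ℕ} {v : Fock n}
    (hv : v ∈ areaSpace n J) (h : ∀ b, b ≠ p → b ≠ q → opA b v = 0 ∧ opB b v = 0) :
    ∃ c : ℂ, v = c • (opFt p q ^ J) (vacuum n) := by
  induction J generalizing v with
  | zero => simpa using eq_smul_vacuum hv
  | succ J ih =>
    obtain ⟨c, hc⟩ := ih (opF_mem_areaSpace p q hv) fun b hp hq => by
      obtain ⟨h1, h2⟩ := h b hp hq
      simp only [opA, opB] at h1 h2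
      simp only [opF, opA, opB, LinearMap.sub_apply, Module.End.mul_apply, map_sub]
      simp only [lower_lower_apply (.inl b), lower_lower_apply (.inr b), h1, h2, map_zero, sub_zero,
        and_self]
    have h0 : ∀ a b, (a ≠ p ∧ a ≠ q) ∨ (b ≠ p ∧ b ≠ q) → opF a b v = 0 := by
      rintro a b (⟨h1, h2⟩ | ⟨h1, h2⟩) <;> obtain ⟨h3, h4⟩ := h _ h1 h2 <;>
      simp only [opA, opB] at h3 h4 <;>
      simp only [opF, opA, opB, LinearMap.sub_apply, Module.End.mul_apply]
      · rw [lower_lower_apply (.inr a), lower_lower_apply (.inl a), h3, h4]; simp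
      · rw [h3, h4]; simp
    have hs := sum_opFt_opF hv
    rw [Fintype.sum_eq_add p q hpq fun a ha => Finset.sum_eq_zero fun b _ => by
        rw [h0 a b (.inl ha), map_zero],
      Fintype.sum_eq_add p q hpq fun b hb => by rw [h0 p b (.inr hb), map_zero],
      Fintype.sum_eq_add p q hpq fun b hb => by rw [h0 q b (.inr hb), map_zero],
      opF_self, opF_self, (opE_opF_opFt_relations (n := n)).F_antisymm p q,
      (opE_opF_opFt_relations (n := n)).Ft_antisymm p q, hc] at hs
    simp only [LinearMap.zero_apply, map_zero, LinearMap.neg_apply, hc, map_neg, map_smul] at hs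
    have hc0 : (2 * ((J + 1 : ℕ) * ((J + 1 : ℕ) + 1)) : ℂ) ≠ 0 := by
      exact_mod_cast (by positivity : 2 * ((J + 1) * ((J + 1) + 1)) ≠ 0)
    -- The Capelli eigenvalue at area `J + 1` is inverted; the factor `2 * c` appears because
    -- $(p,q)$ and $(q,p)$ contribute equally, their two signs cancelling.
    refine ⟨(2 * ((J + 1 : ℕ) * ((J + 1 : ℕ) + 1)) : ℂ)⁻¹ * (2 * c), ?_⟩
    rw [mul_smul, eq_inv_smul_iff₀ hc0, ← hs, pow_succ', Module.End.mul_apply]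
    module

lemma opFt_pow_mem_areaSpace (p q : Fin n) (J : ℕ) :
    (opFt p q ^ J) (vacuum n) ∈ areaSpace n J := by
  induction J with
  | zero => simpa using vacuum_mem_areaSpace
  | succ J ih =>
    rw [pow_succ', Module.End.mul_apply]
    exact opFt_mem_areaSpace p q ih

lemma opE_opFt_pow_of_lt {p q : Fin n} (hp : (p : ℕ) = 0) (hq : (q : ℕ) = 1) (J : ℕ) {a b : Fin n}
    (hab : a < b) : opE a b ((opFt p q ^ J) (vacuum n)) = 0 := by
  induction J with
  | zero => simp [opE_vacuum, hab.ne]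
  | succ J ih =>
    rw [pow_succ', Module.End.mul_apply, opE_opFt_apply, ih, map_zero, zero_add]
    have h1 : b ≠ p := fun h => by subst h; omega
    rw [if_neg h1]
    split_ifs with h2
    · have : a = p := by ext; subst h2; omega
      rw [this, opFt_self]; simp
    · simp

lemma opE_self_opFt_pow {p q : Fin n} (hpq : p ≠ q) (J : ℕ) (a : Fin n) :
    opE a a ((opFt p q ^ J) (vacuum n)) =
      (if a = p ∨ a = q then (J : ℂ) + 1 else 1) • (opFt p q ^ J) (vacuum n) := by
  induction J with
  | zero => simp [opE_vacuum]
  | succ J ih =>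
    rw [pow_succ', Module.End.mul_apply, opE_opFt_apply, ih, map_smul]
    generalize (opFt p q ^ J) (vacuum n) = v
    have := congr($((opE_opF_opFt_relations (n := n)).Ft_antisymm p q) v)
    rw [LinearMap.neg_apply] at this
    push_cast
    by_cases h1 : a = p
    · subst h1
      simp only [if_true, true_or, if_neg hpq]
      module
    · by_cases h2 : a = q
      · subst h2
        simp only [if_true, or_true, if_neg hpq.symm, this]
        module
      · simp [h1, h2]

/-- Passing one more $\widetilde F_{pq}$ adds the eigenvalue $2(J+2)$ of $E_{pp}+E_{qq}$ on
$\widetilde F_{pq}^{J+1}|0\rangle$, and $(J+1)(J+2)+2(J+2)=(J+2)(J+3)$. -/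
lemma opF_opFt_pow {p q : Fin n} (hpq : p ≠ q) (J : ℕ) :
    opF p q ((opFt p q ^ (J + 1)) (vacuum n)) =
      ((J + 1) * (J + 2) : ℂ) • (opFt p q ^ J) (vacuum n) := by
  induction J with
  | zero =>
    rw [pow_succ', Module.End.mul_apply, opF_opFt_apply hpq, pow_zero, Module.End.one_apply,
      opF_vacuum, opE_vacuum, opE_vacuum]
    simp only [map_zero, if_true, Nat.cast_zero]
    module
  | succ J ih =>
    rw [pow_succ', Module.End.mul_apply, opF_opFt_apply hpq, ih, map_smul,
      opE_self_opFt_pow hpq, opE_self_opFt_pow hpq, ← Module.End.mul_apply, ← pow_succ']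
    simp only [true_or, or_true, if_true]
    push_cast
    module

/-- The squared norm is multiplied by $(J+1)(J+2)$ at each step, whence the normalisation of
$\psi_J$. -/
lemma fockInner_opFt_pow {p q : Fin n} (hpq : p ≠ q) (J : ℕ) :
    fockInner n ((opFt p q ^ J) (vacuum n)) ((opFt p q ^ J) (vacuum n)) =
      (J.factorial : ℂ) * ((J + 1).factorial : ℂ) := by
  induction J with
  | zero => simp [fockInner_vacuum_vacuum]
  | succ J ih =>
    nth_rw 2 [pow_succ']
    rw [Module.End.mul_apply, ← fockInner_opF_left, opF_opFt_pow hpq,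
      fockInner_smul_left, ih, Nat.factorial_succ (J + 1), Nat.factorial_succ J]
    simp only [map_mul, map_add, map_natCast, map_one, map_ofNat]
    push_cast
    ring

/-- Weight each quantum by the index of its leg. For $a<b$ the operator $E_{ab}$ moves a quantum
from leg $b$ to leg $a$ and strictly lowers the total weight, so raising stops. -/
lemma exists_highestWeight {W : Submodule ℂ (Fock n)}
    (hE : ∀ (a b : Fin n), ∀ v ∈ W, opE a b v ∈ W) (h0 : W ≠ ⊥) :
    ∃ v ∈ W, v ≠ 0 ∧ ∀ a b, a < b → opE a b v = 0 := by
  have key : ∀ (m : ℕ) (v : Fock n), v ∈ W → v ≠ 0 →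
      BoundedBy (Sum.elim Fin.val Fin.val) m v → ∃ v ∈ W, v ≠ 0 ∧ ∀ a b, a < b → opE a b v = 0 := by
    intro m
    induction m with
    | zero => exact fun v _ hv h => absurd h.eq_zero hv
    | succ m ih =>
      intro v hvW hv hb
      by_cases h : ∀ a b, a < b → opE a b v = 0
      · exact ⟨v, hvW, hv, h⟩
      · push Not at h
        obtain ⟨a, b, hlt, hab⟩ := h
        refine ih _ (hE a b v hvW) hab ?_
        have key (i j : Fin n ⊕ Fin n) (hi : Sum.elim Fin.val Fin.val i = (a : ℕ))
            (hj : Sum.elim Fin.val Fin.val j = (b : ℕ)) :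
            BoundedBy (Sum.elim Fin.val Fin.val) m (raise i (lower j v)) := by
          have h1 := hb.lower j
          rw [hj] at h1
          -- The bound after `lower` is the truncated `m + 1 - b`. When the truncation is effective
          -- the bound is zero, and the vector itself vanishes.
          by_cases hm : (b : ℕ) ≤ m + 1
          · exact (h1.raise i).mono (by omega)
          · rw [Nat.sub_eq_zero_of_le (by omega)] at h1
            rw [h1.eq_zero, map_zero]
            exact fun μ hμ => absurd rfl hμ
        have := (key (.inl a) (.inl b) rfl rfl).add (key (.inr a) (.inr b) rfl rfl)
        rw [opE, if_neg hlt.ne, add_zero]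
        exact this
  obtain ⟨v, hv, hv0⟩ := W.exists_mem_ne_zero_of_ne_bot h0
  obtain ⟨m, hm⟩ := exists_boundedBy (Sum.elim Fin.val Fin.val) v
  exact key m v hv hv0 hm

lemma eq_smul_of_highestWeight {p q : Fin n} (hp : (p : ℕ) = 0) (hq : (q : ℕ) = 1) {J : ℕ}
    {v : Fock n} (hv : v ∈ areaSpace n J) (h : ∀ a b, a < b → opE a b v = 0) :
    ∃ c : ℂ, v = c • (opFt p q ^ J) (vacuum n) := by
  have hpq : p ≠ q := fun h => by subst h; omega
  refine exists_eq_smul_opFt_pow hpq hv fun b h1 h2 => ?_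
  have h1 : (b : ℕ) ≠ p := fun e => h1 (Fin.ext e)
  have h2 : (b : ℕ) ≠ q := fun e => h2 (Fin.ext e)
  exact opA_eq_zero_and_opB_eq_zero hpq (fun e => h1 (congr($e))) (fun e => h2 (congr($e)))
    (h p b (by rw [Fin.lt_def]; omega)) (h q b (by rw [Fin.lt_def]; omega))

lemma opFt_pow_mem_of_stable {p q : Fin n} (hp : (p : ℕ) = 0) (hq : (q : ℕ) = 1) {J : ℕ}
    {W : Submodule ℂ (Fock n)} (hW : W ≤ areaSpace n J)
    (hE : ∀ (a b : Fin n), ∀ v ∈ W, opE a b v ∈ W) (h0 : W ≠ ⊥) :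
    (opFt p q ^ J) (vacuum n) ∈ W := by
  obtain ⟨v, hv, hv0, h⟩ := exists_highestWeight hE h0
  obtain ⟨c, rfl⟩ := eq_smul_of_highestWeight hp hq (hW hv) h
  exact (W.smul_mem_iff (left_ne_zero_of_smul hv0)).1 hv

instance finiteDimensional_areaSpace (J : ℕ) : FiniteDimensional ℂ (areaSpace n J) := by
  classical
  have hfin : {μ : Occ n | ∑ i, μ i = 2 * J}.Finite := by
    refine (Finset.finsuppAntidiag Finset.univ (2 * J)).finite_toSet.subset fun μ hμ => ?_
    simpa using hμ
  have : FiniteDimensional ℂ (Finsupp.supported ℂ ℂ {μ : Occ n | ∑ i, μ i = 2 * J}) := by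
    rw [Finsupp.supported_eq_span_single]
    exact FiniteDimensional.span_of_finite ℂ (hfin.image _)
  refine Submodule.finiteDimensional_of_le (S₂ := Finsupp.supported ℂ ℂ
    {μ : Occ n | ∑ i, μ i = 2 * J}) fun v hv => ?_
  have h2 : opN n v = ((2 * J : ℕ) : ℂ) • v := by simpa using (mem_areaSpace_iff.1 hv).2
  rw [opN_eq_smul_iff] at h2
  rw [Finsupp.mem_supported]
  exact fun μ hμ => h2 μ (by simpa using hμ)

/-- A proper subspace of a finite-dimensional space has a nonzero orthogonal vector. -/
lemma exists_orthogonal {E : Type*} [AddCommGroup E] [Module ℂ E] (B : E →ₗ⋆[ℂ] E →ₗ[ℂ] ℂ)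
    {W H : Submodule ℂ E} [FiniteDimensional ℂ H] (h : W < H) :
    ∃ u ∈ H, u ≠ 0 ∧ ∀ w ∈ W, B w u = 0 := by
  have : FiniteDimensional ℂ W := Submodule.finiteDimensional_of_le h.le
  have hlt := Submodule.finrank_lt_finrank_of_lt h
  let b := Module.finBasis ℂ W
  -- Pairing with a basis of `W` maps `H` to a space of smaller dimension; a nonzero kernel vector
  -- is orthogonal to `W`.
  let T : H →ₗ[ℂ] (Fin (Module.finrank ℂ W) → ℂ) :=
    LinearMap.pi fun i => (B (b i : E)).domRestrict H
  obtain ⟨⟨u, hu⟩, hTu, hu0⟩ := (LinearMap.ker T).exists_mem_ne_zero_of_ne_bot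
    (LinearMap.ker_ne_bot_of_finrank_lt (by simpa using hlt))
  refine ⟨u, hu, fun h => hu0 (Subtype.ext h), fun w hw => ?_⟩
  have h2 : (⟨w, hw⟩ : W) ∈ Submodule.span ℂ (Set.range b) := by rw [b.span_eq]; trivial
  have h3 : ∀ x ∈ Submodule.span ℂ (Set.range b), B (x : E) u = 0 := by
    intro x hx
    induction hx using Submodule.span_induction with
    | mem x hx =>
      obtain ⟨i, rfl⟩ := hx
      exact congr($(LinearMap.mem_ker.1 hTu) i)
    | zero => simp
    | add x y _ _ hx hy => simp [hx, hy]
    | smul c x _ hx => simp [hx]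
  exact h3 _ h2

/-- $E_{ab}$ has adjoint $E_{ba}$, so the orthogonal complement `U` of a stable `W` is stable. If
both are nonzero, both contain $\widetilde F_{12}^J|0\rangle$, which would be orthogonal to itself
although its squared norm is $J!(J+1)!$. -/
lemma areaSpace_irreducible (hn : 2 ≤ n) {J : ℕ} {W : Submodule ℂ (Fock n)}
    (hW : W ≤ areaSpace n J) (hE : ∀ (a b : Fin n), ∀ v ∈ W, opE a b v ∈ W) :
    W = ⊥ ∨ W = areaSpace n J := by
  by_contra! h
  obtain ⟨h0, h1⟩ := h
  obtain ⟨u, hu, hu0, huW⟩ := exists_orthogonal (fockInner n) (lt_of_le_of_ne hW h1)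
  let U : Submodule ℂ (Fock n) :=
    { carrier := {v | v ∈ areaSpace n J ∧ ∀ w ∈ W, fockInner n w v = 0}
      zero_mem' := ⟨zero_mem _, by simp⟩
      add_mem' := fun {v w} hv hw => ⟨add_mem hv.1 hw.1, fun x hx => by
        rw [map_add, hv.2 x hx, hw.2 x hx, add_zero]⟩
      smul_mem' := fun c v hv => ⟨Submodule.smul_mem _ c hv.1, fun x hx => by
        rw [map_smul, hv.2 x hx, smul_zero]⟩ }
  have hU0 : U ≠ ⊥ := by
    rw [Submodule.ne_bot_iff]
    exact ⟨u, ⟨hu, huW⟩, hu0⟩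
  have hUE : ∀ (a b : Fin n), ∀ v ∈ U, opE a b v ∈ U := fun a b v hv =>
    ⟨opE_mem_areaSpace a b hv.1, fun w hw => by
      rw [← fockInner_opE_left]; exact hv.2 _ (hE b a w hw)⟩
  let p : Fin n := ⟨0, by omega⟩
  let q : Fin n := ⟨1, by omega⟩
  have h2 := opFt_pow_mem_of_stable (p := p) (q := q) rfl rfl hW hE h0
  have h3 := opFt_pow_mem_of_stable (p := p) (q := q) rfl rfl
    (W := U) (J := J) (fun v hv => hv.1) hUE hU0
  have h4 := h3.2 _ h2
  rw [fockInner_opFt_pow (by simp [p, q])] at h4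
  simp [Nat.factorial_ne_zero] at h4

/-! ### The normalised highest weight vector -/

lemma psi_eq (hn : 2 ≤ n) (J : ℕ) : psi hn J =
    ((Real.sqrt ((J.factorial : ℝ) * ((J + 1).factorial : ℝ)))⁻¹ : ℂ) •
      ((opFt (⟨0, by omega⟩ : Fin n) ⟨1, by omega⟩) ^ J) (vacuum n) := rfl

lemma fockInner_psi (hn : 2 ≤ n) (J : ℕ) : fockInner n (psi hn J) (psi hn J) = 1 := by
  have hpos : 0 < (J.factorial : ℝ) * ((J + 1).factorial : ℝ) := by positivity
  have h : (Real.sqrt ((J.factorial : ℝ) * ((J + 1).factorial : ℝ)) : ℂ) *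
      (Real.sqrt ((J.factorial : ℝ) * ((J + 1).factorial : ℝ)) : ℂ) =
      (J.factorial : ℂ) * ((J + 1).factorial : ℂ) := by
    rw [← Complex.ofReal_mul, Real.mul_self_sqrt hpos.le]
    push_cast
    rfl
  have h0 : (Real.sqrt ((J.factorial : ℝ) * ((J + 1).factorial : ℝ)) : ℂ) ≠ 0 := by
    exact_mod_cast (Real.sqrt_pos.2 hpos).ne'
  rw [psi_eq, fockInner_smul_left, fockInner_smul_right, fockInner_opFt_pow (by simp), ← h,
    map_inv₀, Complex.conj_ofReal]
  field_simp

lemma psi_ne_zero (hn : 2 ≤ n) (J : ℕ) : psi hn J ≠ 0 := by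
  intro h
  have := fockInner_psi hn J
  simp [h] at this

lemma isHighestWeight_psi (hn : 2 ≤ n) (J : ℕ) :
    IsHighestWeight (fun a : Fin n => if (a : ℕ) < 2 then (J : ℂ) + 1 else 1) (psi hn J) := by
  refine ⟨psi_ne_zero hn J, fun a => ?_, fun a b hab => ?_⟩
  · rw [psi_eq, map_smul, opE_self_opFt_pow (by simp), smul_comm]
    congr 2
    simp only [Fin.ext_iff]
    simp only [eq_iff_iff]
    omega
  · rw [psi_eq, map_smul, opE_opFt_pow_of_lt rfl rfl _ hab, smul_zero]

lemma psi_mem_areaSpace (hn : 2 ≤ n) (J : ℕ) : psi hn J ∈ areaSpace n J :=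
  Submodule.smul_mem _ _ (opFt_pow_mem_areaSpace _ _ _)

lemma eq_exp_smul_psi (hn : 2 ≤ n) {J : ℕ} {l : Fin n → ℂ} {w : Fock n} (hw : w ∈ areaSpace n J)
    (hl : IsHighestWeight l w) (h1 : fockInner n w w = 1) :
    ∃ θ : ℝ, w = Complex.exp (θ * Complex.I) • psi hn J := by
  have hpsi := eq_smul_of_highestWeight (p := ⟨0, by omega⟩) (q := ⟨1, by omega⟩) rfl rfl
    hw hl.2.2
  obtain ⟨c, hc⟩ := hpsi
  obtain ⟨c', hc'⟩ : ∃ c', w = c' • psi hn J := by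
    refine ⟨c * (Real.sqrt ((J.factorial : ℝ) * ((J + 1).factorial : ℝ)) : ℂ), ?_⟩
    rw [hc, psi_eq, smul_smul, mul_assoc, mul_inv_cancel₀, mul_one]
    exact_mod_cast (Real.sqrt_pos.2 (by positivity)).ne'
  rw [hc', fockInner_smul_left, fockInner_smul_right, fockInner_psi,
    mul_one, Complex.conj_mul'] at h1
  have h2 : ‖c'‖ = 1 := by
    have : ‖c'‖ ^ 2 = 1 := by exact_mod_cast h1
    exact (pow_eq_one_iff_of_nonneg (norm_nonneg c') two_ne_zero).1 this
  obtain ⟨θ, hθ⟩ := (Complex.norm_eq_one_iff c').1 h2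
  exact ⟨θ, by rw [hc', ← hθ]⟩

/-! ### The action of the Lie algebra -/

section Quad

variable {E σ : Type} [AddCommGroup E] [Module ℂ E] [Fintype σ]

/-- The quadratic expression `∑ X_ij c_i d_j`. -/
noncomputable def quad (c d : σ → Module.End ℂ E) (X : Matrix σ σ ℂ) : Module.End ℂ E :=
  ∑ i, ∑ j, X i j • (c i * d j)

lemma quad_apply (c d : σ → Module.End ℂ E) (X : Matrix σ σ ℂ) (v : E) :
    quad c d X v = ∑ i, ∑ j, X i j • c i (d j v) := by
  simp [quad, LinearMap.sum_apply]

/-- Normal ordering: the single contraction of $d_j$ with $c_k$ produces the matrix product, and a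
quartic remainder is left. -/
lemma quad_mul [DecidableEq σ] {c d : σ → Module.End ℂ E} (h : CCR c d) (X Y : Matrix σ σ ℂ) :
    quad c d X * quad c d Y = quad c d (X * Y) +
      ∑ i, ∑ j, ∑ k, ∑ l, (X i j * Y k l) • (c i * c k * (d j * d l)) := by
  have h1 : quad c d (X * Y) =
      ∑ i, ∑ j, ∑ k, ∑ l, (X i j * Y k l) • (if j = k then c i * d l else 0) := by
    simp only [quad, Matrix.mul_apply, Finset.sum_smul]
    refine Finset.sum_congr rfl fun i _ => ?_
    rw [Finset.sum_comm]
    refine Finset.sum_congr rfl fun j _ => ?_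
    rw [Finset.sum_comm]
    refine Finset.sum_congr rfl fun l _ => ?_
    simp [smul_ite]
  rw [h1]
  simp only [quad, Finset.sum_mul]
  simp only [Finset.mul_sum, ← Finset.sum_add_distrib]
  refine Finset.sum_congr rfl fun i _ => Finset.sum_congr rfl fun j _ =>
    Finset.sum_congr rfl fun k _ => Finset.sum_congr rfl fun l _ => ?_
  rw [smul_mul_smul_comm, ← smul_add]
  congr 1
  rw [mul_assoc, ← mul_assoc (d j), h.d_c]
  split_ifs <;> simp [mul_assoc, add_mul, mul_add, add_comm]

lemma quad_commutator [DecidableEq σ] {c d : σ → Module.End ℂ E} (h : CCR c d) (X Y : Matrix σ σ ℂ) :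
    quad c d (X * Y - Y * X) = quad c d X * quad c d Y - quad c d Y * quad c d X := by
  have h1 : quad c d (X * Y - Y * X) = quad c d (X * Y) - quad c d (Y * X) := by
    simp only [quad, Matrix.sub_apply, sub_smul, Finset.sum_sub_distrib]
  -- Since the $c$'s commute among themselves, as do the $d$'s, the quartic remainder is symmetric
  -- in `X` and `Y` and drops out of the commutator.
  have h2 : ∑ i, ∑ j, ∑ k, ∑ l, (X i j * Y k l) • (c i * c k * (d j * d l)) =
      ∑ i, ∑ j, ∑ k, ∑ l, (Y i j * X k l) • (c i * c k * (d j * d l)) := by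
    simp only [← Fintype.sum_prod_type']
    refine Fintype.sum_equiv ⟨fun x => (x.2.2.1, x.2.2.2, x.1, x.2.1),
      fun x => (x.2.2.1, x.2.2.2, x.1, x.2.1), fun _ => rfl, fun _ => rfl⟩ _ _ fun x => ?_
    simp only [Equiv.coe_fn_mk, mul_comm (X x.1 x.2.1), h.c_c x.1, h.d_d x.2.1]
  rw [h1, quad_mul h, quad_mul h, h2]
  abel

/-- Covariance of quadratic expressions. -/
lemma map_quad {c d : σ → Module.End ℂ E} {T : Module.End ℂ E} {K L : Matrix σ σ ℂ}
    (hc : ∀ j v, T (c j v) = ∑ i, K i j • c i (T v))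
    (hd : ∀ j v, T (d j v) = ∑ i, L j i • d i (T v)) (X : Matrix σ σ ℂ) (v : E) :
    T (quad c d X v) = quad c d (K * X * L) (T v) := by
  simp only [quad_apply, map_sum, map_smul, hc, hd, Matrix.mul_apply, Finset.sum_smul,
    Finset.smul_sum, Finset.sum_mul]
  simp only [← Fintype.sum_prod_type']
  refine Fintype.sum_equiv ⟨fun x => (x.2.2.1, x.2.2.2, x.2.1, x.1),
      fun x => (x.2.2.2, x.2.2.1, x.1, x.2.1), fun _ => rfl, fun _ => rfl⟩ _ _ fun x => ?_
  simp only [Equiv.coe_fn_mk, smul_smul]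
  congr 1
  ring

end Quad

lemma mem_lieAlg_blocks {V : Mat2 n} (hV : V ∈ lieAlg n) (a b : Fin n) :
    conj (V (.inl a) (.inl b)) = -V (.inl b) (.inl a) ∧
    V (.inr a) (.inr b) = -V (.inl b) (.inl a) ∧
    V (.inl a) (.inr b) = -V (.inl b) (.inr a) ∧
    V (.inr a) (.inl b) = -V (.inr b) (.inl a) ∧
    conj (V (.inl a) (.inr b)) = -V (.inr a) (.inl b) := by
  obtain ⟨-, h1, h2⟩ := hV
  obtain ⟨P, Q, R, S, rfl⟩ : ∃ P Q R S, V = fromBlocks P Q R S :=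
    ⟨_, _, _, _, (fromBlocks_toBlocks V).symm⟩
  simp only [hermForm, symmForm, fromBlocks_conjTranspose, fromBlocks_transpose,
    fromBlocks_multiply, fromBlocks_neg, Matrix.mul_one, Matrix.mul_zero, Matrix.one_mul,
    Matrix.zero_mul, Matrix.mul_neg, Matrix.neg_mul, add_zero, zero_add, fromBlocks_inj,
    neg_neg] at h1 h2
  obtain ⟨p1, p2, p3, p4⟩ := h1
  obtain ⟨q1, q2, q3, q4⟩ := h2
  simp only [fromBlocks_apply₁₁, fromBlocks_apply₁₂, fromBlocks_apply₂₁, fromBlocks_apply₂₂]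
  have p1' := congr($p1 b a)
  have p3' := congr($p3 b a)
  have q1' := congr($q1 b a)
  have q2' := congr($q3 b a)
  have q4' := congr($q4 b a)
  simp only [conjTranspose_apply, transpose_apply, Matrix.neg_apply, RCLike.star_def]
    at p1' p3' q1' q2' q4'
  refine ⟨p1', q2', q4', q1', ?_⟩
  rw [p3', q1', neg_neg]

section Bogoliubov

variable {E : Type} [AddCommGroup E] [Module ℂ E] {c d : Fin n ⊕ Fin n → Module.End ℂ E}

/-- Creation and annihilation are exchanged in the second half; the sign is needed since
$[-B^\dagger,B]=1$. -/
lemma CCR.swap_right (h : CCR c d) :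
    CCR (Sum.elim (c ∘ .inl) (d ∘ .inr)) (Sum.elim (d ∘ .inl) (-(c ∘ .inr))) where
  d_c := by
    rintro (i | i) (j | j) <;> simp [h.d_c, h.c_c (.inl _) (.inr _), h.d_d (.inl _) (.inr _),
      eq_comm]
  c_c := by
    rintro (i | i) (j | j) <;> simp [h.d_c, h.c_c (.inl i), h.d_d (.inr i)]
  d_d := by
    rintro (i | i) (j | j) <;> simp [h.d_c, h.d_d (.inl i), h.c_c (.inr i)]

/-- The lower right block contributes $-V_{ba}B_a(-B_b^\dagger)=V_{ba}(B_b^\dagger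
B_a+\delta_{ab})$, with $V_{ba}$ taken from the upper left block. This reordering is what puts the
constant $\delta_{ab}$ into $E_{ab}$. By antisymmetry of the off-diagonal blocks the two halves of
$F$ and of $\widetilde F$ contribute equally, which absorbs the factors $\tfrac12$. -/
lemma sum_eq_quad (h : CCR c d) {V : Mat2 n} (hV : V ∈ lieAlg n) :
    ∑ a, ∑ b, (V (.inl a) (.inl b) •
        (c (.inl a) * d (.inl b) + c (.inr a) * d (.inr b) + if a = b then 1 else 0)
      + ((1 / 2 : ℂ) * V (.inr a) (.inl b)) • (d (.inr a) * d (.inl b) - d (.inl a) * d (.inr b))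
      + ((1 / 2 : ℂ) * V (.inl a) (.inr b)) • (c (.inr a) * c (.inl b) - c (.inl a) * c (.inr b)))
    = quad (Sum.elim (c ∘ .inl) (d ∘ .inr)) (Sum.elim (d ∘ .inl) (-(c ∘ .inr))) V := by
  have hV := mem_lieAlg_blocks hV
  have hF : ∑ a : Fin n, ∑ b : Fin n, V (.inr a) (.inl b) • (d (.inl a) * d (.inr b)) =
      -∑ a : Fin n, ∑ b : Fin n, V (.inr a) (.inl b) • (d (.inr a) * d (.inl b)) := by
    rw [Finset.sum_comm]
    simp only [← Finset.sum_neg_distrib]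
    refine Finset.sum_congr rfl fun a _ => Finset.sum_congr rfl fun b _ => ?_
    rw [(hV b a).2.2.2.1, h.d_d, neg_smul]
  have hFt : ∑ a : Fin n, ∑ b : Fin n, V (.inl a) (.inr b) • (c (.inr a) * c (.inl b)) =
      -∑ a : Fin n, ∑ b : Fin n, V (.inl a) (.inr b) • (c (.inl a) * c (.inr b)) := by
    rw [Finset.sum_comm]
    simp only [← Finset.sum_neg_distrib]
    refine Finset.sum_congr rfl fun a _ => Finset.sum_congr rfl fun b _ => ?_
    rw [(hV b a).2.2.1, h.c_c, neg_smul]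
  have hE : ∑ a : Fin n, ∑ b : Fin n, V (.inr a) (.inr b) • (d (.inr a) * c (.inr b)) =
      -∑ a : Fin n, ∑ b : Fin n, V (.inl a) (.inl b) •
        (c (.inr a) * d (.inr b) + if a = b then 1 else 0) := by
    rw [Finset.sum_comm]
    simp only [← Finset.sum_neg_distrib]
    refine Finset.sum_congr rfl fun a _ => Finset.sum_congr rfl fun b _ => ?_
    rw [(hV b a).2.1, h.d_c, neg_smul]
    simp only [Sum.inr.injEq, eq_comm (a := b)]
  simp only [quad, Fintype.sum_sum_type, Sum.elim_inl, Sum.elim_inr, Function.comp_apply,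
    Pi.neg_apply, mul_neg, smul_neg, Finset.sum_neg_distrib, Finset.sum_add_distrib, hE, mul_smul,
    smul_sub, Finset.sum_sub_distrib, ← Finset.smul_sum, hF, hFt, add_assoc, smul_add]
  module

end Bogoliubov

/-- The operators `(A†, B)`. -/
noncomputable def zc : Fin n ⊕ Fin n → Module.End ℂ (Fock n) :=
  Sum.elim (raise ∘ .inl) (lower ∘ .inr)

/-- The operators `(A, -B†)`. -/
noncomputable def zd : Fin n ⊕ Fin n → Module.End ℂ (Fock n) :=
  Sum.elim (lower ∘ .inl) (-(raise ∘ .inr))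

lemma ccr_zc_zd : CCR (zc (n := n)) zd := ccr.swap_right

lemma opOf_eq_quad {V : Mat2 n} (hV : V ∈ lieAlg n) : opOf V = quad zc zd V :=
  sum_eq_quad ccr hV

lemma opOf_lie {V W : Mat2 n} (hV : V ∈ lieAlg n) (hW : W ∈ lieAlg n) :
    opOf (V * W - W * V) = opOf V * opOf W - opOf W * opOf V := by
  have h : V * W - W * V ∈ lieAlg n := (lieAlg n).lie_mem hV hW
  rw [opOf_eq_quad h, opOf_eq_quad hV, opOf_eq_quad hW, quad_commutator ccr_zc_zd]

lemma opOf_add (V W : Mat2 n) : opOf (V + W) = opOf V + opOf W := by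
  simp only [opOf, ← Finset.sum_add_distrib]
  refine Finset.sum_congr rfl fun a _ => Finset.sum_congr rfl fun b _ => ?_
  simp only [Matrix.add_apply]
  module

lemma opOf_smul (c : ℂ) (V : Mat2 n) : opOf (c • V) = c • opOf V := by
  simp only [opOf, Finset.smul_sum]
  refine Finset.sum_congr rfl fun a _ => Finset.sum_congr rfl fun b _ => ?_
  simp only [Matrix.smul_apply, smul_eq_mul]
  module

lemma opOf_apply (V : Mat2 n) (v : Fock n) :
    opOf V v = ∑ a : Fin n, ∑ b : Fin n, (V (.inl a) (.inl b) • opE a b v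
      + ((1 / 2 : ℂ) * V (.inr a) (.inl b)) • opF a b v
      + ((1 / 2 : ℂ) * V (.inl a) (.inr b)) • opFt a b v) := by
  simp [opOf, LinearMap.sum_apply]

lemma opOf_mem_intertwinerSpace (V : Mat2 n) {v : Fock n} (hv : v ∈ intertwinerSpace n) :
    opOf V v ∈ intertwinerSpace n := by
  rw [intertwinerSpace_eq] at hv ⊢
  rw [opOf_apply]
  refine Submodule.sum_mem _ fun a _ => Submodule.sum_mem _ fun b _ => ?_
  exact add_mem (add_mem (Submodule.smul_mem _ _ (map_mem_invariants (isScalarOp_opE a b) hv))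
    (Submodule.smul_mem _ _ (map_mem_invariants (isScalarOp_opF a b) hv)))
    (Submodule.smul_mem _ _ (map_mem_invariants (isScalarOp_opFt a b) hv))

lemma fockInner_opOf_left {V : Mat2 n} (hV : V ∈ lieAlg n) (v w : Fock n) :
    fockInner n (opOf V v) w = -fockInner n v (opOf V w) := by
  have h := mem_lieAlg_blocks hV
  have hFt (a b : Fin n) (v w : Fock n) :
      fockInner n (opFt a b v) w = fockInner n v (opF a b w) := by
    rw [← fockInner_conj, ← fockInner_opF_left, fockInner_conj]
  have hZ (a b : Fin n) : conj (V (.inr a) (.inl b)) = -V (.inl a) (.inr b) := by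
    rw [← neg_eq_iff_eq_neg.2 (h a b).2.2.2.2, map_neg, Complex.conj_conj]
  simp only [opOf_apply, map_sum, map_add, LinearMap.sum_apply, LinearMap.add_apply,
    fockInner_smul_left, fockInner_smul_right, fockInner_opE_left, fockInner_opF_left, hFt,
    map_mul, (h _ _).1, (h _ _).2.2.2.2, hZ, Finset.sum_add_distrib]
  rw [Finset.sum_comm]
  simp only [neg_mul, mul_neg, Finset.sum_neg_distrib, map_div₀, map_one, map_ofNat]
  abel

/-! ### Second quantisation of linear maps -/

/-- The norm of the monomial `∏ (a†_i)^{μ_i}` applied to the vacuum. -/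
noncomputable def monomialNorm (μ : Occ n) : ℂ := ∏ i, (Real.sqrt ((μ i).factorial) : ℂ)

lemma monomialNorm_ne_zero (μ : Occ n) : monomialNorm μ ≠ 0 := by
  refine Finset.prod_ne_zero_iff.2 fun i _ => ?_
  exact_mod_cast (Real.sqrt_pos.2 (Nat.cast_pos.2 (Nat.factorial_pos _))).ne'

lemma monomialNorm_add_single (μ : Occ n) (i : Fin n ⊕ Fin n) :
    monomialNorm (μ + Finsupp.single i 1) = Real.sqrt (μ i + 1) * monomialNorm μ := by
  classical
  have h (j : Fin n ⊕ Fin n) : (Real.sqrt (((μ + Finsupp.single i 1 : Occ n) j).factorial) : ℂ) =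
      (if j = i then (Real.sqrt (μ i + 1) : ℂ) else 1) * Real.sqrt ((μ j).factorial) := by
    by_cases hj : j = i
    · subst hj
      rw [if_pos rfl, Finsupp.add_apply, Finsupp.single_eq_same, Nat.factorial_succ, Nat.cast_mul,
        Real.sqrt_mul (by positivity)]
      push_cast
      rfl
    · simp [hj]
  simp only [monomialNorm, h, Finset.prod_mul_distrib, Finset.prod_ite_eq', Finset.mem_univ,
    if_true]

/-- The Bargmann transform. -/
noncomputable def toPoly : Fock n →ₗ[ℂ] MvPolynomial (Fin n ⊕ Fin n) ℂ :=
  Finsupp.linearCombination ℂ fun μ : Occ n => MvPolynomial.monomial μ (monomialNorm μ)⁻¹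

/-- The inverse Bargmann transform. -/
noncomputable def ofPoly : MvPolynomial (Fin n ⊕ Fin n) ℂ →ₗ[ℂ] Fock n :=
  (MvPolynomial.basisMonomials (Fin n ⊕ Fin n) ℂ).constr ℂ fun μ => monomialNorm μ • ket μ

lemma toPoly_ket (μ : Occ n) : toPoly (ket μ) = MvPolynomial.monomial μ (monomialNorm μ)⁻¹ := by
  simp [toPoly, ket]

lemma ofPoly_monomial (μ : Occ n) (c : ℂ) :
    ofPoly (MvPolynomial.monomial μ c) = (c * monomialNorm μ) • ket μ := by
  have h := (MvPolynomial.basisMonomials (Fin n ⊕ Fin n) ℂ).constr_basis ℂ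
    (fun μ => monomialNorm μ • ket μ) μ
  rw [MvPolynomial.coe_basisMonomials] at h
  have : MvPolynomial.monomial μ c = c • MvPolynomial.monomial μ (1 : ℂ) := by
    rw [MvPolynomial.smul_monomial]; simp
  rw [this, map_smul, mul_smul]
  exact congr(c • $h)

/-- The normalisation by $\sqrt{\mu!}$ turns creation into multiplication by a variable, so a linear
substitution of creation operators becomes an algebra homomorphism of polynomials. -/
lemma toPoly_raise (i : Fin n ⊕ Fin n) (v : Fock n) :
    toPoly (raise i v) = MvPolynomial.X i * toPoly v := by
  induction v using Finsupp.induction_linear with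
  | zero => simp
  | add v w hv hw => simp [hv, hw, mul_add]
  | single μ c =>
    have : Finsupp.single μ c = c • ket μ := by simp [ket]
    rw [this, map_smul, map_smul, map_smul, raise_ket, map_smul, toPoly_ket, toPoly_ket,
      MvPolynomial.X, mul_smul_comm, MvPolynomial.monomial_mul, MvPolynomial.smul_monomial,
      monomialNorm_add_single, add_comm μ, one_mul]
    have h0 : (Real.sqrt (μ i + 1) : ℂ) ≠ 0 := by
      exact_mod_cast (Real.sqrt_pos.2 (by positivity)).ne'
    congr 2
    have h1 := monomialNorm_ne_zero μ
    rw [smul_eq_mul]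
    field_simp

lemma ofPoly_X_mul (i : Fin n ⊕ Fin n) (p : MvPolynomial (Fin n ⊕ Fin n) ℂ) :
    ofPoly (MvPolynomial.X i * p) = raise i (ofPoly p) := by
  induction p using MvPolynomial.induction_on' with
  | monomial μ c =>
    rw [ofPoly_monomial, MvPolynomial.X, MvPolynomial.monomial_mul, ofPoly_monomial, map_smul,
      raise_ket, add_comm, monomialNorm_add_single, smul_smul]
    congr 1
    ring
  | add p q hp hq => rw [mul_add, map_add, hp, hq, map_add, map_add]

/-- The operator of the Fock space that fixes the vacuum and maps the creation operators
linearly by the matrix `V`. -/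
noncomputable def secondQuant (V : Mat2 n) : Module.End ℂ (Fock n) :=
  ofPoly ∘ₗ (MvPolynomial.aeval fun j => ∑ i, V i j • (MvPolynomial.X i :
    MvPolynomial (Fin n ⊕ Fin n) ℂ)).toLinearMap ∘ₗ toPoly

lemma secondQuant_vacuum (V : Mat2 n) : secondQuant V (vacuum n) = vacuum n := by
  have h1 : monomialNorm (0 : Occ n) = 1 := by simp [monomialNorm]
  have h2 : toPoly (vacuum n) = 1 := by rw [vacuum, toPoly_ket, h1, inv_one]; rfl
  have h3 : ofPoly (1 : MvPolynomial (Fin n ⊕ Fin n) ℂ) = vacuum n := by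
    rw [← MvPolynomial.C_1, ← MvPolynomial.monomial_zero', ofPoly_monomial, h1]; simp [vacuum]
  simp [secondQuant, h2, h3]

lemma secondQuant_raise (V : Mat2 n) (j : Fin n ⊕ Fin n) (v : Fock n) :
    secondQuant V (raise j v) = ∑ i, V i j • raise i (secondQuant V v) := by
  simp only [secondQuant, LinearMap.comp_apply, toPoly_raise, AlgHom.toLinearMap_apply, map_mul,
    MvPolynomial.aeval_X, Finset.sum_mul, map_sum, smul_mul_assoc, map_smul, ofPoly_X_mul]

lemma secondQuant_one (v : Fock n) : secondQuant 1 v = v := by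
  induction v using fock_induction with
  | vac => exact secondQuant_vacuum _
  | add v w hv hw => rw [map_add, hv, hw]
  | smul c v hv => rw [map_smul, hv]
  | rai i v hv =>
    rw [secondQuant_raise, hv]
    simp [Matrix.one_apply, -Fintype.sum_sum_type]

lemma secondQuant_mul (V W : Mat2 n) (v : Fock n) :
    secondQuant (V * W) v = secondQuant V (secondQuant W v) := by
  induction v using fock_induction with
  | vac => simp only [secondQuant_vacuum]
  | add v w hv hw => rw [map_add, hv, hw, map_add, map_add]
  | smul c v hv => rw [map_smul, hv, map_smul, map_smul]
  | rai i v hv =>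
    simp only [secondQuant_raise, hv, map_sum, map_smul, Matrix.mul_apply, Finset.sum_smul,
      Finset.smul_sum, smul_smul]
    rw [Finset.sum_comm]
    simp only [mul_comm]

lemma sum_lower_sum_raise (x y : Fin n ⊕ Fin n → ℂ) (u : Fock n) :
    ∑ i, y i • lower i (∑ j, x j • raise j u) =
      ∑ j, x j • raise j (∑ i, y i • lower i u) + ∑ i, (y i * x i) • u := by
  have h1 (i) : y i • lower i (∑ j, x j • raise j u) =
      ∑ j, (y i * x j) • raise j (lower i u) + (y i * x i) • u := by
    have h2 (j) : lower i (x j • raise j u) =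
        x j • raise j (lower i u) + if i = j then x j • u else 0 := by
      rw [map_smul, lower_raise_apply, smul_add, smul_ite, smul_zero]
    rw [map_sum, Finset.sum_congr rfl fun j _ => h2 j, Finset.sum_add_distrib, Finset.sum_ite_eq,
      if_pos (Finset.mem_univ i), smul_add, Finset.smul_sum, smul_smul]
    congr 1
    exact Finset.sum_congr rfl fun j _ => smul_smul _ _ _
  have h3 (j) : x j • raise j (∑ i, y i • lower i u) = ∑ i, (y i * x j) • raise j (lower i u) := by
    rw [map_sum, Finset.smul_sum]
    exact Finset.sum_congr rfl fun i _ => by rw [map_smul, smul_smul, mul_comm]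
  rw [Finset.sum_congr rfl fun i _ => h1 i, Finset.sum_congr rfl fun j _ => h3 j,
    Finset.sum_add_distrib, Finset.sum_comm]

/-- Both sides kill the vacuum and obey the same rule when passing a creation operator; the
contraction terms agree because $V^*V=1$. -/
lemma secondQuant_lower {V : Mat2 n} (hV : Vᴴ * V = 1) (j : Fin n ⊕ Fin n) (v : Fock n) :
    secondQuant V (lower j v) = ∑ i, Vᴴ j i • lower i (secondQuant V v) := by
  induction v using fock_induction with
  | vac => simp only [secondQuant_vacuum, lower_vacuum, smul_zero, Finset.sum_const_zero, map_zero]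
  | add v w hv hw =>
    simp only [map_add, hv, hw, smul_add, Finset.sum_add_distrib]
  | smul c v hv =>
    simp only [map_smul, hv, Finset.smul_sum]
    exact Finset.sum_congr rfl fun i _ => smul_comm _ _ _
  | rai k v hv =>
    have h1 : ∑ i, Vᴴ j i * V i k = if j = k then 1 else 0 := by
      rw [← Matrix.mul_apply, hV, Matrix.one_apply]
    have h2 : secondQuant V (if j = k then v else 0) =
        ∑ i, (Vᴴ j i * V i k) • secondQuant V v := by
      rw [← Finset.sum_smul, h1]; split_ifs <;> simp
    rw [lower_raise_apply, map_add, h2, secondQuant_raise, secondQuant_raise, hv]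
    exact (sum_lower_sum_raise (fun m => V m k) (fun i => Vᴴ j i) _).symm

lemma fockInner_vacuum_secondQuant (V : Mat2 n) (w : Fock n) :
    fockInner n (vacuum n) (secondQuant V w) = fockInner n (vacuum n) w := by
  induction w using fock_induction with
  | vac => rw [secondQuant_vacuum]
  | add v w hv hw => rw [map_add, map_add, map_add, hv, hw]
  | smul c v hv => rw [map_smul, map_smul, map_smul, hv]
  | rai k v hv =>
    have h (i) (u : Fock n) : fockInner n (vacuum n) (raise i u) = 0 := by
      rw [← fockInner_lower_left, lower_vacuum, map_zero, LinearMap.zero_apply]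
    rw [secondQuant_raise, h, map_sum]
    exact Finset.sum_eq_zero fun i _ => by rw [fockInner_smul_right, h, mul_zero]

/-- A creation operator in the left argument is moved to the right as an annihilation operator, and
its transform under $V$ is moved by the same rule, which reduces everything to the vacuum. -/
lemma fockInner_secondQuant {V : Mat2 n} (hV : Vᴴ * V = 1) (v w : Fock n) :
    fockInner n (secondQuant V v) (secondQuant V w) = fockInner n v w := by
  induction v using fock_induction generalizing w with
  | vac => rw [secondQuant_vacuum, fockInner_vacuum_secondQuant]
  | add v v' hv hv' => simp only [map_add, LinearMap.add_apply, hv, hv']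
  | smul c v hv => simp only [map_smul, fockInner_smul_left, hv]
  | rai k v hv =>
    rw [fockInner_raise_left, ← hv, secondQuant_lower hV, secondQuant_raise]
    simp only [map_sum, LinearMap.sum_apply, fockInner_smul_left, fockInner_raise_left,
      fockInner_smul_right, conjTranspose_apply, RCLike.star_def]

/-! ### The action of the maximal compact subgroup -/

/-- The unitary matrix `U` of an element `diag(U, conj U)` of the maximal compact subgroup. -/
def uPart (k : maxCompact n) : Matrix (Fin n) (Fin n) ℂ := (kMat k).toBlocks₁₁

lemma uPart_mem (k : maxCompact n) : uPart k ∈ unitaryGroup (Fin n) ℂ := by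
  obtain ⟨U, hU, h⟩ := k.2
  rwa [uPart, kMat, h, toBlocks_fromBlocks₁₁]

lemma kMat_eq (k : maxCompact n) :
    kMat k = fromBlocks (uPart k) 0 0 ((uPart k).map conj) := by
  obtain ⟨U, hU, h⟩ := k.2
  rw [uPart, kMat, h, toBlocks_fromBlocks₁₁]

lemma kMat_mul (k l : maxCompact n) : kMat (k * l) = kMat k * kMat l := rfl

lemma kMat_mul_inv (k : maxCompact n) : kMat k * kMat k⁻¹ = 1 := by
  rw [← kMat_mul, mul_inv_cancel]; rfl

lemma uPart_mul (k l : maxCompact n) : uPart (k * l) = uPart k * uPart l := by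
  have h := kMat_mul k l
  rw [kMat_eq (k * l), kMat_eq k, kMat_eq l, fromBlocks_multiply, fromBlocks_inj] at h
  simpa using h.1

lemma uPart_one : uPart (1 : maxCompact n) = 1 := by
  have h : kMat (1 : maxCompact n) = 1 := rfl
  rw [uPart, h, ← fromBlocks_one, toBlocks_fromBlocks₁₁]

lemma conjTranspose_mul_uPart (k : maxCompact n) : (uPart k)ᴴ * uPart k = 1 :=
  mem_unitaryGroup_iff'.1 (uPart_mem k)

lemma uPart_mul_conjTranspose (k : maxCompact n) : uPart k * (uPart k)ᴴ = 1 :=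
  mem_unitaryGroup_iff.1 (uPart_mem k)

lemma kMat_inv (k : maxCompact n) : kMat k⁻¹ = (kMat k)ᴴ := by
  have h : (kMat k)ᴴ * kMat k = 1 := by
    have h1 := conjTranspose_mul_uPart k
    have h2 : ((uPart k).map conj)ᴴ * (uPart k).map conj = 1 := by
      have h3 : ((uPart k).map conj)ᴴ = ((uPart k)ᴴ).map conj := by ext; simp
      rw [h3, ← Matrix.map_mul, h1]
      simp
    rw [kMat_eq, fromBlocks_conjTranspose, fromBlocks_multiply, h1, h2]
    simp
  rw [← one_mul (kMat k⁻¹), ← h, Matrix.mul_assoc, kMat_mul_inv, Matrix.mul_one]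

/-- The matrix by which `diag(U, conj U)` acts on the creation operators `(A†, B†)`. -/
def doubled (U : Matrix (Fin n) (Fin n) ℂ) : Mat2 n := fromBlocks U 0 0 U

lemma doubled_mul (U V : Matrix (Fin n) (Fin n) ℂ) :
    doubled (U * V) = doubled U * doubled V := by
  simp [doubled, fromBlocks_multiply]

lemma doubled_one : doubled (1 : Matrix (Fin n) (Fin n) ℂ) = 1 := fromBlocks_one

lemma doubled_conjTranspose (U : Matrix (Fin n) (Fin n) ℂ) : (doubled U)ᴴ = doubled Uᴴ := by
  simp [doubled, fromBlocks_conjTranspose]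

lemma conjTranspose_mul_doubled (k : maxCompact n) :
    (doubled (uPart k))ᴴ * doubled (uPart k) = 1 := by
  rw [doubled_conjTranspose, ← doubled_mul, conjTranspose_mul_uPart, doubled_one]

lemma doubled_mul_conjTranspose (k : maxCompact n) :
    doubled (uPart k) * (doubled (uPart k))ᴴ = 1 := by
  rw [doubled_conjTranspose, ← doubled_mul, uPart_mul_conjTranspose, doubled_one]

/-- The action of `diag(U, conj U)` on the Fock space. -/
noncomputable def compactOp (k : maxCompact n) : Module.End ℂ (Fock n) :=
  (uPart k).det • secondQuant (doubled (uPart k))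

lemma compactOp_apply (k : maxCompact n) (v : Fock n) :
    compactOp k v = (uPart k).det • secondQuant (doubled (uPart k)) v := rfl

lemma compactOp_one (v : Fock n) : compactOp 1 v = v := by
  rw [compactOp_apply, uPart_one, doubled_one, secondQuant_one, det_one, one_smul]

lemma compactOp_mul (k l : maxCompact n) (v : Fock n) :
    compactOp (k * l) v = compactOp k (compactOp l v) := by
  rw [compactOp_apply, compactOp_apply, compactOp_apply, uPart_mul, doubled_mul, secondQuant_mul,
    det_mul, map_smul, mul_smul]

lemma fockInner_compactOp (k : maxCompact n) (v w : Fock n) :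
    fockInner n (compactOp k v) (compactOp k w) = fockInner n v w := by
  have h := congr(($(conjTranspose_mul_uPart k)).det)
  rw [det_mul, det_conjTranspose, det_one] at h
  rw [compactOp_apply, compactOp_apply, fockInner_smul_left, fockInner_smul_right,
    fockInner_secondQuant (conjTranspose_mul_doubled k), ← mul_assoc]
  exact (congr($h * _)).trans (one_mul _)

/-! ### Covariance of quadratic expressions under $K$ -/

lemma compactOp_quad {c d : Fin n ⊕ Fin n → Module.End ℂ (Fock n)} {k : maxCompact n}
    {K L : Mat2 n}
    (hc : ∀ j v, secondQuant (doubled (uPart k)) (c j v) =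
      ∑ i, K i j • c i (secondQuant (doubled (uPart k)) v))
    (hd : ∀ j v, secondQuant (doubled (uPart k)) (d j v) =
      ∑ i, L j i • d i (secondQuant (doubled (uPart k)) v)) (X : Mat2 n) (v : Fock n) :
    compactOp k (quad c d X v) = quad c d (K * X * L) (compactOp k v) := by
  rw [compactOp_apply, compactOp_apply, map_smul]
  congr 1
  exact map_quad hc hd X v

lemma compactOp_quad_raise_lower (k : maxCompact n) (X : Mat2 n) (v : Fock n) :
    compactOp k (quad raise lower X v) =
      quad raise lower (doubled (uPart k) * X * (doubled (uPart k))ᴴ) (compactOp k v) :=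
  compactOp_quad (fun j v => secondQuant_raise _ j v)
    (fun j v => secondQuant_lower (conjTranspose_mul_doubled k) j v) X v

/-- The one-particle space is $\mathbb C^n\otimes\mathbb C^2$, with $U$ acting on the first factor.
The matrices of $J_z,J_\pm$ and of the number operator act on the second factor only, so they
commute with $\mathrm{diag}(U,U)$. -/
lemma compactOp_quad_of_commute (k : maxCompact n) {X : Mat2 n}
    (h : doubled (uPart k) * X = X * doubled (uPart k)) (v : Fock n) :
    compactOp k (quad raise lower X v) = quad raise lower X (compactOp k v) := by
  rw [compactOp_quad_raise_lower, h, Matrix.mul_assoc, doubled_mul_conjTranspose, Matrix.mul_one]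

lemma opN_eq_quad (v : Fock n) : opN n v = quad raise lower 1 v := by
  rw [quad_apply, opN, LinearMap.sum_apply]
  refine Finset.sum_congr rfl fun i _ => ?_
  simp only [Matrix.one_apply, ite_smul, one_smul, zero_smul, Finset.sum_ite_eq, Finset.mem_univ,
    if_true, Module.End.mul_apply]

lemma opJp_eq_quad (v : Fock n) : opJp n v = quad raise lower (fromBlocks 0 1 0 0) v := by
  rw [quad_apply, opJp, LinearMap.sum_apply]
  simp [Matrix.one_apply, ite_smul, opAd, opB]

lemma opJm_eq_quad (v : Fock n) : opJm n v = quad raise lower (fromBlocks 0 0 1 0) v := by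
  rw [quad_apply, opJm, LinearMap.sum_apply]
  simp [Matrix.one_apply, ite_smul, opBd, opA]

lemma opJz_eq_quad (v : Fock n) :
    opJz n v = quad raise lower (fromBlocks ((1 / 2 : ℂ) • 1) 0 0 (-(1 / 2 : ℂ) • 1)) v := by
  rw [quad_apply, opJz_eq_sub, LinearMap.smul_apply, LinearMap.sub_apply, LinearMap.sum_apply,
    LinearMap.sum_apply, smul_sub, Finset.smul_sum, Finset.smul_sum]
  simp [Matrix.one_apply, ite_smul, opAd, opBd, opA, opB, sub_eq_add_neg]

lemma compactOp_opN (k : maxCompact n) (v : Fock n) :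
    compactOp k (opN n v) = opN n (compactOp k v) := by
  rw [opN_eq_quad, opN_eq_quad]
  exact compactOp_quad_of_commute k (by simp) v

lemma compactOp_mem_invariants (k : maxCompact n) {v : Fock n} (hv : v ∈ invariants n) :
    compactOp k v ∈ invariants n := by
  rw [mem_invariants_iff] at hv ⊢
  rw [opJz_eq_quad, opJp_eq_quad, opJm_eq_quad] at hv ⊢
  obtain ⟨h1, h2, h3⟩ := hv
  refine ⟨?_, ?_, ?_⟩
  · rw [← compactOp_quad_of_commute k (by simp [doubled, fromBlocks_multiply]), h1, map_zero]
  · rw [← compactOp_quad_of_commute k (by simp [doubled, fromBlocks_multiply]), h2, map_zero]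
  · rw [← compactOp_quad_of_commute k (by simp [doubled, fromBlocks_multiply]), h3, map_zero]

lemma compactOp_mem_areaSpace (k : maxCompact n) {J : ℕ} {v : Fock n} (hv : v ∈ areaSpace n J) :
    compactOp k v ∈ areaSpace n J := by
  rw [mem_areaSpace_iff] at hv ⊢
  exact ⟨compactOp_mem_invariants k hv.1, by rw [← compactOp_opN, hv.2, map_smul]⟩

/-- $A^\dagger$ transforms by $U$ and $B$, as an annihilation operator, by $\overline U$. So
$(A^\dagger,B)$ carries the defining representation of $K$ and $(A,-B^\dagger)$ its dual, which
makes $V\mapsto\sum V_{ij}z_iz'_j$ equivariant under conjugation. -/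
lemma secondQuant_zc (k : maxCompact n) (j : Fin n ⊕ Fin n) (v : Fock n) :
    secondQuant (doubled (uPart k)) (zc j v) =
      ∑ i, kMat k i j • zc i (secondQuant (doubled (uPart k)) v) := by
  rw [kMat_eq]
  rcases j with j | j
  · simp [zc, secondQuant_raise, doubled]
  · simp [zc, secondQuant_lower (conjTranspose_mul_doubled k)]
    simp [doubled]

lemma secondQuant_zd (k : maxCompact n) (j : Fin n ⊕ Fin n) (v : Fock n) :
    secondQuant (doubled (uPart k)) (zd j v) =
      ∑ i, kMat k⁻¹ j i • zd i (secondQuant (doubled (uPart k)) v) := by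
  rw [kMat_inv, kMat_eq]
  rcases j with j | j
  · simp [zd, secondQuant_lower (conjTranspose_mul_doubled k)]
    simp [doubled]
  · simp [zd, secondQuant_raise, doubled]

lemma conj_mem_lieAlg (k : maxCompact n) {V : Mat2 n} (hV : V ∈ lieAlg n) :
    kMat k * V * kMat k⁻¹ ∈ lieAlg n := by
  obtain ⟨v1, v2, v3⟩ := hV
  obtain ⟨-, g2, g3⟩ := (k : group n).2
  change (kMat k)ᴴ * hermForm n * kMat k = hermForm n at g2
  change (kMat k)ᵀ * symmForm n * kMat k = symmForm n at g3
  have e := kMat_mul_inv k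
  generalize kMat k⁻¹ = h at *
  generalize kMat k = g at *
  have e1 : hᴴ * gᴴ = 1 := by rw [← conjTranspose_mul, e, conjTranspose_one]
  have e2 : hᵀ * gᵀ = 1 := by rw [← transpose_mul, e, transpose_one]
  -- With `h` the inverse of `g`, invariance of each form says that the adjoint or transpose of `g`
  -- passes through it as `h`, and that of `h` as `g`.
  have f1 : gᴴ * hermForm n = hermForm n * h := by
    calc gᴴ * hermForm n = gᴴ * hermForm n * (g * h) := by rw [e, Matrix.mul_one]
      _ = _ := by rw [← Matrix.mul_assoc, g2]
  have f2 : gᵀ * symmForm n = symmForm n * h := by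
    calc gᵀ * symmForm n = gᵀ * symmForm n * (g * h) := by rw [e, Matrix.mul_one]
      _ = _ := by rw [← Matrix.mul_assoc, g3]
  have f3 : hᴴ * hermForm n = hermForm n * g := by
    calc hᴴ * hermForm n = hᴴ * (gᴴ * hermForm n * g) := by rw [g2]
      _ = hᴴ * gᴴ * (hermForm n * g) := by simp only [Matrix.mul_assoc]
      _ = _ := by rw [e1, Matrix.one_mul]
  have f4 : hᵀ * symmForm n = symmForm n * g := by
    calc hᵀ * symmForm n = hᵀ * (gᵀ * symmForm n * g) := by rw [g3]
      _ = hᵀ * gᵀ * (symmForm n * g) := by simp only [Matrix.mul_assoc]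
      _ = _ := by rw [e2, Matrix.one_mul]
  refine ⟨?_, ?_, ?_⟩
  · have : h * g = 1 := mul_eq_one_comm.1 e
    rw [Matrix.trace_mul_comm, ← Matrix.mul_assoc, this, Matrix.one_mul, v1]
  · rw [conjTranspose_mul, conjTranspose_mul, Matrix.mul_assoc, Matrix.mul_assoc, f1,
      ← Matrix.mul_assoc Vᴴ, v2, Matrix.neg_mul, Matrix.mul_neg, ← Matrix.mul_assoc,
      ← Matrix.mul_assoc, f3]
    simp only [Matrix.mul_assoc]
  · rw [transpose_mul, transpose_mul, Matrix.mul_assoc, Matrix.mul_assoc, f2,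
      ← Matrix.mul_assoc Vᵀ, v3, Matrix.neg_mul, Matrix.mul_neg, ← Matrix.mul_assoc,
      ← Matrix.mul_assoc, f4]
    simp only [Matrix.mul_assoc]

lemma compactOp_opOf (k : maxCompact n) {X : Mat2 n} (hX : X ∈ lieAlg n) (v : Fock n) :
    compactOp k (opOf X v) = opOf (kMat k * X * kMat k⁻¹) (compactOp k v) := by
  rw [opOf_eq_quad hX, opOf_eq_quad (conj_mem_lieAlg k hX)]
  exact compactOp_quad (secondQuant_zc k) (secondQuant_zd k) X v

/-- Every vector is `K`-finite. -/
lemma exists_finiteDimensional_secondQuant (v : Fock n) :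
    ∃ U : Submodule ℂ (Fock n), FiniteDimensional ℂ U ∧ ∀ V, secondQuant V v ∈ U := by
  induction v using fock_induction with
  | vac =>
    refine ⟨Submodule.span ℂ {vacuum n}, FiniteDimensional.span_singleton ℂ _, fun V => ?_⟩
    rw [secondQuant_vacuum]
    exact Submodule.mem_span_singleton_self _
  | add v w hv hw =>
    obtain ⟨U₁, h₁, hU₁⟩ := hv
    obtain ⟨U₂, h₂, hU₂⟩ := hw
    refine ⟨U₁ ⊔ U₂, Submodule.finiteDimensional_sup _ _, fun V => ?_⟩
    rw [map_add]
    exact Submodule.add_mem_sup (hU₁ V) (hU₂ V)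
  | smul c v hv =>
    obtain ⟨U, h, hU⟩ := hv
    exact ⟨U, h, fun V => by rw [map_smul]; exact U.smul_mem c (hU V)⟩
  | rai j v hv =>
    obtain ⟨U, h, hU⟩ := hv
    refine ⟨⨆ i, U.map (raise i), ?_, fun V => ?_⟩
    · have (i : Fin n ⊕ Fin n) : FiniteDimensional ℂ (U.map (raise i)) := Module.Finite.map _ _
      exact Submodule.finite_iSup _
    · rw [secondQuant_raise]
      exact Submodule.sum_mem _ fun i _ => Submodule.smul_mem _ _ <|
        Submodule.mem_iSup_of_mem i <| Submodule.mem_map_of_mem (hU V)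

lemma exists_finiteDimensional_compactOp (v : Fock n) :
    ∃ U : Submodule ℂ (Fock n), FiniteDimensional ℂ U ∧ ∀ k, compactOp k v ∈ U := by
  obtain ⟨U, h, hU⟩ := exists_finiteDimensional_secondQuant v
  exact ⟨U, h, fun k => U.smul_mem _ (hU _)⟩

lemma continuous_uPart : Continuous (uPart : maxCompact n → Matrix (Fin n) (Fin n) ℂ) := by
  have h : Continuous (kMat : maxCompact n → Mat2 n) :=
    Units.continuous_val.comp (continuous_subtype_val.comp continuous_subtype_val)
  exact continuous_matrix fun i j => h.matrix_elem _ _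

/-- Matrix coefficients are polynomial in the entries of $U$. The functional is kept general in the
induction so that it can absorb each creation operator. -/
lemma continuous_compactOp (v : Fock n) (f : Fock n →ₗ[ℂ] ℂ) :
    Continuous fun k : maxCompact n => f (compactOp k v) := by
  have key : Continuous fun k : maxCompact n => f (secondQuant (doubled (uPart k)) v) := by
    induction v using fock_induction generalizing f with
    | vac => simp only [secondQuant_vacuum]; exact continuous_const
    | add v w hv hw => simp only [map_add]; exact (hv f).add (hw f)
    | smul c v hv => simp only [map_smul]; exact (hv f).const_smul c
    | rai j v hv =>
      simp only [secondQuant_raise, map_sum, map_smul, smul_eq_mul]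
      refine continuous_finsetSum _ fun i _ => Continuous.mul ?_ (hv (f ∘ₗ raise i))
      have : Continuous fun k : maxCompact n => doubled (uPart k) :=
        continuous_uPart.matrix_fromBlocks continuous_const continuous_const continuous_uPart
      exact this.matrix_elem _ _
  simp only [compactOp_apply, map_smul]
  exact continuous_uPart.matrix_det.smul key

/-! ### The derivative of the action of the maximal compact subgroup -/

/-- In the Leibniz expansion a nontrivial permutation moves at least two indices, so after
differentiating one factor another off-diagonal entry of the identity remains and kills the term. -/
lemma hasDerivAt_det {M : ℝ → Matrix (Fin n) (Fin n) ℂ} {X : Matrix (Fin n) (Fin n) ℂ}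
    (h0 : M 0 = 1) (hM : ∀ i j, HasDerivAt (fun t => M t i j) (X i j) 0) :
    HasDerivAt (fun t => (M t).det) X.trace 0 := by
  simp only [det_apply]
  have h (σ : Equiv.Perm (Fin n)) : HasDerivAt
      (fun t => Equiv.Perm.sign σ • ∏ i, M t (σ i) i) (if σ = 1 then X.trace else 0) 0 := by
    have h1 := (HasDerivAt.fun_finsetProd (u := Finset.univ) fun i _ => hM (σ i) i).const_smul
      (Equiv.Perm.sign σ)
    refine h1.congr_deriv ?_
    split_ifs with hσ
    · subst hσ
      simp [h0, Matrix.trace]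
    · rw [Finset.sum_eq_zero, smul_zero]
      intro i _
      obtain ⟨j, hj⟩ : ∃ j, j ≠ i ∧ σ j ≠ j := by
        by_contra! hc
        apply hσ
        ext1 j
        by_cases hj : j = i
        · subst hj
          by_contra hne
          exact hne (σ.injective (hc _ hne))
        · exact hc j hj
      rw [Finset.prod_eq_zero (i := j) (by simp [hj.1]), zero_smul]
      rw [h0, Matrix.one_apply_ne hj.2]
  have := HasDerivAt.fun_sum (u := Finset.univ) fun σ _ => h σ
  simpa using this

lemma hasDerivAt_exp_entry (Y : Mat2 n) (i j : Fin n ⊕ Fin n) :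
    HasDerivAt (fun t : ℝ => NormedSpace.exp (t • Y) i j) (Y i j) 0 := by
  -- An auxiliary algebra norm for differentiating the exponential; the conclusion concerns single
  -- entries.
  let _ : NormedRing (Mat2 n) := Matrix.linftyOpNormedRing
  let _ : NormedAlgebra ℝ (Mat2 n) := Matrix.linftyOpNormedAlgebra
  have h := hasDerivAt_exp_smul_const (𝕂 := ℝ) Y 0
  rw [zero_smul, NormedSpace.exp_zero, one_mul] at h
  have h2 := hasDerivAt_pi.1 (hasDerivAt_pi.1 h i) j
  exact h2

lemma opE_raise_inl (a b j : Fin n) (v : Fock n) :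
    opE a b (raise (.inl j) v) =
      raise (.inl j) (opE a b v) + if b = j then raise (.inl a) v else 0 := by
  simp only [opE, opA, opB, opAd, opBd, LinearMap.add_apply, Module.End.mul_apply, map_add,
    lower_raise_apply, raise_raise_apply (.inl j), Sum.inl.injEq, reduceCtorEq, if_false, add_zero]
  split_ifs <;> simp <;> abel

lemma opE_raise_inr (a b j : Fin n) (v : Fock n) :
    opE a b (raise (.inr j) v) =
      raise (.inr j) (opE a b v) + if b = j then raise (.inr a) v else 0 := by
  simp only [opE, opA, opB, opAd, opBd, LinearMap.add_apply, Module.End.mul_apply, map_add,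
    lower_raise_apply, raise_raise_apply (.inr j), Sum.inr.injEq, reduceCtorEq, if_false, add_zero]
  split_ifs <;> simp <;> abel

lemma sum_opE_raise (X : Matrix (Fin n) (Fin n) ℂ) (j : Fin n ⊕ Fin n) (v : Fock n) :
    ∑ a, ∑ b, X a b • opE a b (raise j v) =
      raise j (∑ a, ∑ b, X a b • opE a b v) + ∑ i, doubled X i j • raise i v := by
  have h1 (r : Fin n ⊕ Fin n) :
      raise r (∑ a, ∑ b, X a b • opE a b v) = ∑ a, ∑ b, X a b • raise r (opE a b v) := by
    simp only [map_sum, map_smul]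
  rcases j with j | j
  · simp only [opE_raise_inl, smul_add, Finset.sum_add_distrib, h1]
    simp [doubled, smul_ite]
  · simp only [opE_raise_inr, smul_add, Finset.sum_add_distrib, h1]
    simp [doubled, smul_ite]

lemma sum_opE_vacuum (X : Matrix (Fin n) (Fin n) ℂ) :
    ∑ a, ∑ b, X a b • opE a b (vacuum n) = X.trace • vacuum n := by
  simp [opE_vacuum, smul_ite, Matrix.trace, Finset.sum_smul]

/-- On the vacuum the derivative is that of the determinant, namely the trace, which matches the
constant in $E_{aa}$. The product rule for one more creation operator reproduces `sum_opE_raise`. -/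
lemma hasDerivAt_det_smul_secondQuant {M : ℝ → Matrix (Fin n) (Fin n) ℂ}
    {X : Matrix (Fin n) (Fin n) ℂ} (h0 : M 0 = 1)
    (hM : ∀ i j, HasDerivAt (fun t => M t i j) (X i j) 0) (v : Fock n) (f : Fock n →ₗ[ℂ] ℂ) :
    HasDerivAt (fun t => (M t).det * f (secondQuant (doubled (M t)) v))
      (f (∑ a, ∑ b, X a b • opE a b v)) 0 := by
  induction v using fock_induction generalizing f with
  | vac =>
    simp only [secondQuant_vacuum, sum_opE_vacuum, map_smul]
    exact (hasDerivAt_det h0 hM).mul_const _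
  | add v w hv hw =>
    simp only [map_add, mul_add, smul_add, Finset.sum_add_distrib]
    exact (hv f).fun_add (hw f)
  | smul c v hv =>
    refine (((hv f).const_mul c).congr_deriv ?_).congr_of_eventuallyEq (.of_forall fun t => ?_)
    · rw [← smul_eq_mul, ← map_smul]
      simp only [Finset.smul_sum, map_smul, smul_comm c]
    · simp only [map_smul, smul_eq_mul]
      ring
  | rai j v hv =>
    have hD (i : Fin n ⊕ Fin n) :
        HasDerivAt (fun t => doubled (M t) i j) (doubled X i j) 0 := by
      rcases i with i | i <;> rcases j with j | j
      · exact hM i j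
      · exact hasDerivAt_const _ _
      · exact hasDerivAt_const _ _
      · exact hM i j
    have h := HasDerivAt.fun_sum (u := Finset.univ) fun i _ => (hD i).fun_mul (hv (f ∘ₗ raise i))
    refine (h.congr_deriv ?_).congr_of_eventuallyEq (.of_forall fun t => ?_)
    · rw [h0, doubled_one, det_one, secondQuant_one, sum_opE_raise, map_add,
        map_sum f (fun i => doubled X i j • raise i v), Finset.sum_add_distrib, add_comm]
      congr 1
      · rw [Finset.sum_eq_single j (fun i _ hi => by rw [Matrix.one_apply_ne hi, zero_mul])
          (fun hj => absurd (Finset.mem_univ j) hj), Matrix.one_apply_eq, one_mul]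
        rfl
      · exact Finset.sum_congr rfl fun i _ => by
          rw [one_mul, map_smul, smul_eq_mul, LinearMap.comp_apply]
    · simp only [secondQuant_raise, map_sum, map_smul, smul_eq_mul, Finset.mul_sum,
        LinearMap.comp_apply]
      exact Finset.sum_congr rfl fun i _ => by ring

lemma hasDerivAt_compactOp {Y : Mat2 n} {γ : ℝ → maxCompact n}
    (hγ : ∀ t : ℝ, kMat (γ t) = NormedSpace.exp (t • Y)) (v : Fock n) (f : Fock n →ₗ[ℂ] ℂ) :
    HasDerivAt (fun t : ℝ => f (compactOp (γ t) v)) (f (opOf Y v)) 0 := by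
  have hK (i j : Fin n ⊕ Fin n) : HasDerivAt (fun t => kMat (γ t) i j) (Y i j) 0 := by
    simp only [hγ]
    exact hasDerivAt_exp_entry Y i j
  -- The curve stays in $K$, so its off-diagonal blocks are identically zero and so are their
  -- derivatives.
  have h12 (a b : Fin n) : Y (.inl a) (.inr b) = 0 := by
    have h := hK (.inl a) (.inr b)
    simp only [kMat_eq, fromBlocks_apply₁₂, Matrix.zero_apply] at h
    exact h.unique (hasDerivAt_const _ _)
  have h21 (a b : Fin n) : Y (.inr a) (.inl b) = 0 := by
    have h := hK (.inr a) (.inl b)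
    simp only [kMat_eq, fromBlocks_apply₂₁, Matrix.zero_apply] at h
    exact h.unique (hasDerivAt_const _ _)
  have h0 : uPart (γ 0) = 1 := by
    rw [uPart, hγ, zero_smul, NormedSpace.exp_zero, ← fromBlocks_one, toBlocks_fromBlocks₁₁]
  have h := hasDerivAt_det_smul_secondQuant (M := fun t => uPart (γ t)) (X := Y.toBlocks₁₁) h0
    (fun i j => hK (.inl i) (.inl j)) v f
  refine (h.congr_deriv ?_).congr_of_eventuallyEq (.of_forall fun t => ?_)
  · congr 1
    rw [opOf_apply]
    refine Finset.sum_congr rfl fun a _ => Finset.sum_congr rfl fun b _ => ?_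
    rw [h12, h21]
    simp [toBlocks₁₁]
  · exact (congr(f $(compactOp_apply (γ t) v))).trans (map_smul f _ _)

/-! ### The `(𝔤, K)`-module of intertwiners -/

/-- The `(𝔤, K)`-module structure on a subspace of a complex vector space given by operators
that preserve the subspace. -/
noncomputable def GKModule.ofSubmodule {E : Type} [AddCommGroup E] [Module ℂ E] (H : Submodule ℂ E)
    (ρ : lieAlg n → Module.End ℂ E) (R : maxCompact n → Module.End ℂ E)
    (hρ : ∀ X, ∀ v ∈ H, ρ X v ∈ H) (hR : ∀ k, ∀ v ∈ H, R k v ∈ H)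
    (hadd : ∀ (X Y : lieAlg n) v, ρ (X + Y) v = ρ X v + ρ Y v)
    (hsmul : ∀ (c : ℝ) (X : lieAlg n) v, ρ (c • X) v = (c : ℂ) • ρ X v)
    (hlie : ∀ (X Y : lieAlg n) v, ρ ⁅X, Y⁆ v = ρ X (ρ Y v) - ρ Y (ρ X v))
    (hone : ∀ v, R 1 v = v) (hmul : ∀ k l v, R (k * l) v = R k (R l v))
    (had : ∀ (k : maxCompact n) (X : lieAlg n), ∃ Y : lieAlg n, (Y : Mat2 n) = kMat k * (X : Mat2 n) * kMat k⁻¹ ∧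
      ∀ v, R k (ρ X v) = ρ Y (R k v))
    (hfin : ∀ v, ∃ U : Submodule ℂ E, FiniteDimensional ℂ U ∧ ∀ k, R k v ∈ U)
    (hcont : ∀ (v : E) (f : E →ₗ[ℂ] ℂ), Continuous fun k => f (R k v))
    (hderiv : ∀ (Y : lieAlg n) (γ : ℝ → maxCompact n),
      (∀ t : ℝ, kMat (γ t) = NormedSpace.exp (t • (Y : Mat2 n))) →
      ∀ (v : E) (f : E →ₗ[ℂ] ℂ), HasDerivAt (fun t : ℝ => f (R (γ t) v)) (f (ρ Y v)) 0) :
    GKModule n H where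
  lieAction :=
    { toFun := fun X => (ρ X).restrict (hρ X)
      map_add' := fun X Y => by
        ext v : 2
        exact hadd X Y v
      map_smul' := fun c X => by
        ext v : 2
        exact hsmul c X v
      map_lie' := fun {X Y} => by
        ext v : 2
        exact hlie X Y v }
  compactAction :=
    { toFun := fun k => (R k).restrict (hR k)
      map_one' := by
        ext v : 2
        exact hone v
      map_mul' := fun k l => by
        ext v : 2
        exact hmul k l v }
  ad_compat k X := by
    obtain ⟨Y, hY, h⟩ := had k X
    refine ⟨Y, hY, ?_⟩
    ext v : 2
    exact h v
  finite v := by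
    obtain ⟨U, hU, h⟩ := hfin v
    have : FiniteDimensional ℂ (U.comap H.subtype) :=
      Module.Finite.of_injective
        ((H.subtype.restrict fun x hx => hx : U.comap H.subtype →ₗ[ℂ] U)) fun x y hxy =>
          Subtype.ext (Subtype.ext congr(($hxy : E)))
    refine Submodule.finiteDimensional_of_le (S₂ := U.comap H.subtype) (Submodule.span_le.2 ?_)
    rintro _ ⟨k, rfl⟩
    exact h k
  continuous v f := by
    -- A functional on the subspace extends to the whole space, where the regularity assumptions are
    -- stated.
    obtain ⟨g, rfl⟩ := LinearMap.exists_extend f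
    exact hcont v g
  deriv Y γ hγ v f := by
    obtain ⟨g, rfl⟩ := LinearMap.exists_extend f
    exact hderiv Y γ hγ v g

/-! ### Recovering the generators from the real Lie algebra -/

lemma mem_lieAlg_of_blocks {X Y : Matrix (Fin n) (Fin n) ℂ} (hX : Xᴴ = -X) (hY : Yᵀ = -Y) :
    (fromBlocks X Y (-Y.map conj) (X.map conj) : Mat2 n) ∈ lieAlg n := by
  have h1 : (X.map conj)ᴴ = Xᵀ := by ext; simp
  have h2 : (Y.map conj)ᴴ = Yᵀ := by ext; simp
  have h3 : (X.map conj)ᵀ = Xᴴ := by ext; simp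
  have h4 : Yᴴ = -Y.map conj := by
    have : Yᴴ = (Yᵀ).map conj := by ext; simp
    rw [this, hY]
    ext
    simp
  have h5 : Xᵀ = -X.map conj := by
    have : Xᵀ = (Xᴴ).map conj := by ext; simp
    rw [this, hX]
    ext
    simp
  have h6 : (Y.map conj)ᵀ = Yᴴ := by ext; simp
  refine ⟨?_, ?_, ?_⟩
  · have : (X.map conj).trace = -X.trace := by
      rw [← trace_transpose, h3, hX, trace_neg]
    have h : (fromBlocks X Y (-Y.map conj) (X.map conj)).trace = X.trace + (X.map conj).trace := by
      simp [Matrix.trace]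
    rw [h, this, add_neg_cancel]
  · simp [hermForm, fromBlocks_conjTranspose, fromBlocks_multiply, fromBlocks_neg, hX, h1, h2, h4,
      h5, hY]
  · simp [symmForm, fromBlocks_transpose, fromBlocks_multiply, fromBlocks_neg, hX, h3, h4,
      h5, h6, hY]

lemma sum_single_smul {E : Type} [AddCommGroup E] [Module ℂ E] (i j : Fin n) (c : ℂ)
    (f : Fin n → Fin n → E) : ∑ a, ∑ b, Matrix.single i j c a b • f a b = c • f i j := by
  rw [Finset.sum_eq_single i, Finset.sum_eq_single j]
  · simp
  · intro b _ hb
    rw [Matrix.single_apply_of_col_ne _ _ hb.symm, zero_smul]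
  · simp
  · intro a _ ha
    exact Finset.sum_eq_zero fun b _ => by
      rw [Matrix.single_apply_of_row_ne ha.symm _ _, zero_smul]
  · simp

lemma opOf_diagonal (X W : Matrix (Fin n) (Fin n) ℂ) (v : Fock n) :
    opOf (fromBlocks X (0 : Matrix (Fin n) (Fin n) ℂ) (-(0 : Matrix (Fin n) (Fin n) ℂ).map conj) W)
      v = ∑ a, ∑ b, X a b • opE a b v := by
  simp [opOf_apply]

lemma opOf_offDiagonal (Y W : Matrix (Fin n) (Fin n) ℂ) (v : Fock n) :
    opOf (fromBlocks 0 Y (-Y.map conj) W) v = (1 / 2 : ℂ) • (∑ a, ∑ b, Y a b • opFt a b v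
      - ∑ a, ∑ b, Y.map conj a b • opF a b v) := by
  rw [opOf_apply]
  simp only [fromBlocks_apply₁₁, fromBlocks_apply₁₂, fromBlocks_apply₂₁, Matrix.zero_apply,
    Matrix.neg_apply, zero_smul, zero_add, mul_smul, neg_smul, mul_neg,
    Finset.sum_add_distrib, Finset.sum_neg_distrib, ← Finset.smul_sum]
  module

/-- A complex subspace stable under $\mathfrak g$ is stable under its complexification. The elements
with $X=\Delta_{ab}-\Delta_{ba}$ and $X=i(\Delta_{ab}+\Delta_{ba})$ act as $E_{ab}-E_{ba}$ and
$i(E_{ab}+E_{ba})$; those with $Y=\Delta_{ab}-\Delta_{ba}$ and $i$ times it act as $\widetilde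
F_{ab}-F_{ab}$ and $i(\widetilde F_{ab}+F_{ab})$. -/
lemma opOf_mem_of_stable {W : Submodule ℂ (Fock n)}
    (hW : ∀ X ∈ lieAlg n, ∀ v ∈ W, opOf X v ∈ W) (a b : Fin n) {v : Fock n} (hv : v ∈ W) :
    opE a b v ∈ W ∧ opF a b v ∈ W ∧ opFt a b v ∈ W := by
  have hE1 := hW _ (mem_lieAlg_of_blocks (X := single a b 1 - single b a 1) (Y := 0)
    (by simp) (by simp)) v hv
  have hE2 := hW _ (mem_lieAlg_of_blocks (X := single a b Complex.I + single b a Complex.I) (Y := 0)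
    (by simp [← Matrix.single_neg, add_comm]) (by simp)) v hv
  have hF1 := hW _ (mem_lieAlg_of_blocks (X := 0) (Y := single a b 1 - single b a 1)
    (by simp) (by simp)) v hv
  have hF2 := hW _ (mem_lieAlg_of_blocks (X := 0)
    (Y := single a b Complex.I - single b a Complex.I) (by simp) (by simp)) v hv
  have hm (c : ℂ) (i j : Fin n) : (single i j c).map conj = single i j (conj c) :=
    Matrix.map_single _ _ _ _
  have hm2 (c : ℂ) : (single a b c - single b a c).map conj =
      single a b (conj c) - single b a (conj c) := by
    rw [← hm, ← hm]
    exact Matrix.map_sub _ (map_sub _) _ _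
  rw [opOf_diagonal] at hE1 hE2
  rw [opOf_offDiagonal, hm2] at hF1 hF2
  have a1 := congr($((opE_opF_opFt_relations (n := n)).F_antisymm a b) v)
  have a2 := congr($((opE_opF_opFt_relations (n := n)).Ft_antisymm a b) v)
  rw [LinearMap.neg_apply] at a1 a2
  simp only [Matrix.sub_apply, Matrix.add_apply, sub_smul, add_smul, Finset.sum_add_distrib,
    Finset.sum_sub_distrib, sum_single_smul, a1, a2, map_one, Complex.conj_I] at hE1 hE2 hF1 hF2
  have hI : Complex.I * Complex.I = -1 := Complex.I_mul_I
  refine ⟨?_, ?_, ?_⟩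
  · convert W.smul_mem (1 / 2 : ℂ) (W.sub_mem hE1 (W.smul_mem Complex.I hE2)) using 1
    simp only [smul_add, smul_smul, hI]
    module
  · convert W.smul_mem (-1 / 2 : ℂ) (W.add_mem hF1 (W.smul_mem Complex.I hF2)) using 1
    match_scalars <;> linear_combination (1 / 2 : ℂ) * hI
  · convert W.smul_mem (1 / 2 : ℂ) (W.sub_mem hF1 (W.smul_mem Complex.I hF2)) using 1
    match_scalars <;> linear_combination (1 / 2 : ℂ) * hI

lemma compactOp_mem_intertwinerSpace (k : maxCompact n) {v : Fock n}
    (hv : v ∈ intertwinerSpace n) : compactOp k v ∈ intertwinerSpace n := by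
  rw [intertwinerSpace_eq] at hv ⊢
  exact compactOp_mem_invariants k hv

/-- The `(𝔤, K)`-module of all intertwiners. -/
noncomputable def intertwinerModule (n : ℕ) : GKModule n (intertwinerSpace n) := by
  refine GKModule.ofSubmodule (n := n) (E := Fock n) (intertwinerSpace n)
    (fun X => opOf (X : Mat2 n)) compactOp ?_ ?_ ?_ ?_ ?_ ?_ ?_ ?_ ?_ ?_ ?_
  · intro X v hv
    exact opOf_mem_intertwinerSpace (X : Mat2 n) hv
  · intro k v hv
    exact compactOp_mem_intertwinerSpace k hv
  · intro X Y _
    exact congr($(opOf_add (X : Mat2 n) Y) _)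
  · intro c X v
    have : ((c • X : lieAlg n) : Mat2 n) = (c : ℂ) • (X : Mat2 n) := by ext; simp
    rw [this, opOf_smul]
    rfl
  · intro X Y _
    exact congr($(opOf_lie X.2 Y.2) _)
  · exact compactOp_one
  · exact compactOp_mul
  · exact fun k X => ⟨⟨_, conj_mem_lieAlg k X.2⟩, rfl, compactOp_opOf k X.2⟩
  · exact exists_finiteDimensional_compactOp
  · exact continuous_compactOp
  · exact fun _ _ hγ v f => hasDerivAt_compactOp hγ v f

lemma intertwinerModule_lieAction (X : lieAlg n) (v : intertwinerSpace n) :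
    (((intertwinerModule n).lieAction X v : intertwinerSpace n) : Fock n) =
      opOf (X : Mat2 n) v := rfl

lemma intertwinerModule_isUnitary : (intertwinerModule n).IsUnitary
    ((fockInner n).domRestrict₁₂ (intertwinerSpace n) (intertwinerSpace n)) where
  hermitian v w := fockInner_conj v.1 w.1
  pos _ hv := fockInner_self_re_pos fun h => hv (Subtype.ext h)
  skew X v w := fockInner_opOf_left X.2 v.1 w.1
  unitary k v w := fockInner_compactOp k v.1 w.1

lemma vacuum_mem_intertwinerSpace : vacuum n ∈ intertwinerSpace n :=
  Submodule.mem_iSup_of_mem 0 vacuum_mem_areaSpace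

lemma intertwinerModule_isIrreducible : (intertwinerModule n).IsIrreducible := by
  refine ⟨⟨⟨⟨_, vacuum_mem_intertwinerSpace⟩, 0, fun h => vacuum_ne_zero congr(($h).1)⟩⟩, ?_⟩
  intro W hW _
  -- The submodule is pushed forward to the Fock space, where irreducibility under the generators
  -- applies.
  have h := intertwinerSpace_irreducible (W := W.map (intertwinerSpace n).subtype)
    (Submodule.map_subtype_le _ _) fun a b v hv => (opOf_mem_of_stable (fun X hX v hv => by
      obtain ⟨w, hw, rfl⟩ := hv
      exact ⟨_, hW ⟨X, hX⟩ w hw, rfl⟩) a b hv).2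
  rcases h with h | h
  · left
    rw [eq_bot_iff]
    intro w hw
    have : w.1 ∈ W.map (intertwinerSpace n).subtype := ⟨w, hw, rfl⟩
    rw [h] at this
    exact Subtype.ext this
  · right
    rw [eq_top_iff]
    intro w _
    have : w.1 ∈ W.map (intertwinerSpace n).subtype := by
      rw [h]
      exact w.2
    obtain ⟨w', hw', e⟩ := this
    rwa [← Subtype.ext e]

end SOStar

theorem mainTheorem9 (n : ℕ) :
    -- the operators are scalar operators for SU(2)
    (∀ a b : Fin n, SOStar.IsScalarOp (SOStar.opE a b) ∧ SOStar.IsScalarOp (SOStar.opF a b) ∧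
      SOStar.IsScalarOp (SOStar.opFt a b)) ∧
    -- they satisfy the commutation relations of the complexification of so*(2n)
    SOStar.Relations (n := n) (L := Module.End ℂ (SOStar.Fock n))
      SOStar.opE SOStar.opF SOStar.opFt ∧
    -- adjointness relations
    (∀ (a b : Fin n) (v w : SOStar.Fock n),
      SOStar.fockInner n (SOStar.opE a b v) w = SOStar.fockInner n v (SOStar.opE b a w) ∧
      SOStar.fockInner n (SOStar.opF a b v) w = SOStar.fockInner n v (SOStar.opFt a b w)) ∧
    -- the intertwiner space consists of all the invariant vectors
    SOStar.intertwinerSpace n = SOStar.invariants n ∧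
    -- the intertwiner space is stable under the operators, and irreducible under them
    (∀ (a b : Fin n), ∀ v ∈ SOStar.intertwinerSpace n,
      SOStar.opE a b v ∈ SOStar.intertwinerSpace n ∧
      SOStar.opF a b v ∈ SOStar.intertwinerSpace n ∧
      SOStar.opFt a b v ∈ SOStar.intertwinerSpace n) ∧
    (∀ W : Submodule ℂ (SOStar.Fock n), W ≤ SOStar.intertwinerSpace n →
      (∀ (a b : Fin n), ∀ v ∈ W,
        SOStar.opE a b v ∈ W ∧ SOStar.opF a b v ∈ W ∧ SOStar.opFt a b v ∈ W) →
      W = ⊥ ∨ W = SOStar.intertwinerSpace n) ∧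
    -- it is an irreducible unitary (𝔤, K)-module for SO*(2n), with 𝔤 acting by these operators
    (∃ π : SOStar.GKModule n (SOStar.intertwinerSpace n),
      (∀ (X : SOStar.lieAlg n) (v : SOStar.intertwinerSpace n),
        ((π.lieAction X v : SOStar.intertwinerSpace n) : SOStar.Fock n) =
          SOStar.opOf (X : SOStar.Mat2 n) v) ∧
      π.IsUnitary ((SOStar.fockInner n).domRestrict₁₂
        (SOStar.intertwinerSpace n) (SOStar.intertwinerSpace n)) ∧
      π.IsIrreducible ∧
      -- U(n) preserves the spaces of fixed total area
      (∀ (J : ℕ) (k : SOStar.maxCompact n) (v : SOStar.intertwinerSpace n),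
        (v : SOStar.Fock n) ∈ SOStar.areaSpace n J →
        ((π.compactAction k v : SOStar.intertwinerSpace n) : SOStar.Fock n) ∈
          SOStar.areaSpace n J)) ∧
    -- the irreducible U(n)-module of total area J, and its normalised highest weight vector
    (∀ (hn : 2 ≤ n) (J : ℕ),
      (∀ (a b : Fin n), ∀ v ∈ SOStar.areaSpace n J, SOStar.opE a b v ∈ SOStar.areaSpace n J) ∧
      (∀ W : Submodule ℂ (SOStar.Fock n), W ≤ SOStar.areaSpace n J →
        (∀ (a b : Fin n), ∀ v ∈ W, SOStar.opE a b v ∈ W) →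
        W = ⊥ ∨ W = SOStar.areaSpace n J) ∧
      SOStar.psi hn J ∈ SOStar.areaSpace n J ∧
      SOStar.fockInner n (SOStar.psi hn J) (SOStar.psi hn J) = 1 ∧
      SOStar.IsHighestWeight (fun a : Fin n => if (a : ℕ) < 2 then (J : ℂ) + 1 else 1)
        (SOStar.psi hn J) ∧
      (∀ (l : Fin n → ℂ) (w : SOStar.Fock n), w ∈ SOStar.areaSpace n J →
        SOStar.IsHighestWeight l w → SOStar.fockInner n w w = 1 →
        ∃ θ : ℝ, w = Complex.exp (θ * Complex.I) • SOStar.psi hn J)) := by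
  refine ⟨fun a b => ⟨SOStar.isScalarOp_opE a b, SOStar.isScalarOp_opF a b,
      SOStar.isScalarOp_opFt a b⟩, SOStar.opE_opF_opFt_relations,
    fun a b v w => ⟨SOStar.fockInner_opE_left a b v w, SOStar.fockInner_opF_left a b v w⟩,
    SOStar.intertwinerSpace_eq, fun a b v hv => ?_,
    fun W hW h => SOStar.intertwinerSpace_irreducible hW fun a b v hv => (h a b v hv).2,
    ⟨SOStar.intertwinerModule n, SOStar.intertwinerModule_lieAction,
      SOStar.intertwinerModule_isUnitary, SOStar.intertwinerModule_isIrreducible,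
      fun J k v hv => SOStar.compactOp_mem_areaSpace k hv⟩,
    fun hn J => ⟨fun a b v hv => SOStar.opE_mem_areaSpace a b hv,
      fun W hW hE => SOStar.areaSpace_irreducible hn hW hE, SOStar.psi_mem_areaSpace hn J,
      SOStar.fockInner_psi hn J, SOStar.isHighestWeight_psi hn J,
      fun l w hw hl h1 => SOStar.eq_exp_smul_psi hn hw hl h1⟩⟩
  rw [SOStar.intertwinerSpace_eq] at hv ⊢
  exact ⟨SOStar.map_mem_invariants (SOStar.isScalarOp_opE a b) hv,
    SOStar.map_mem_invariants (SOStar.isScalarOp_opF a b) hv,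
    SOStar.map_mem_invariants (SOStar.isScalarOp_opFt a b) hv⟩
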